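/- Let $N\ge 2$ be an integer, let $R,p,q>0$ and $0<A<B$ be constants, and let $g\in C^\infty([0,R])$ be positive on $[0,R]$; none of these depends on $\epsilon$. For every $\epsilon>0$ let $U_\epsilon\in C^1([0,R])\cap C^\infty((0,R))$ be the solution of $$\epsilon^2 g(r)\Big[U_\epsilon''(r)+\Big(\frac{N-1}{r}+\frac{g'(r)}{g(r)}\Big)U_\epsilon'(r)\Big]=\frac{R^N}{N}\left(\frac{Ae^{pU_\epsilon(r)}}{\int_0^R s^{N-1}e^{pU_\epsilon(s)}\,ds}-\frac{Be^{-qU_\epsilon(r)}}{\int_0^R s^{N-1}e^{-qU_\epsilon(s)}\,ds}\right),\quad r\in(0,R),$$ $$\int_0^R s^{N-1}U_\epsilon(s)\,ds=0,\qquad U_\epsilon'(0)=0,\qquad U_\epsilon'(R)=\frac{R(A-B)}{\epsilon^2Ng(R)},$$ and let $$\rho_\epsilon(r)=-\frac{R^N}{N}\left(\frac{Ae^{pU_\epsilon(r)}}{\int_0^R s^{N-1}e^{pU_\epsilon(s)}\,ds}-\frac{Be^{-qU_\epsilon(r)}}{\int_0^R s^{N-1}e^{-qU_\epsilon(s)}\,ds}\right).$$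 Below, $o_\epsilon(1)$ denotes a quantity tending to $0$ as $\epsilon\downarrow0$. **(I)** Let $r_\epsilon\in(0,R)$ (for small $\epsilon>0$), $\pi(\epsilon)=R-r_\epsilon$, and suppose that for some $\beta_0>1$ independent of $\epsilon$: $\lim_{\epsilon\downarrow0}\pi(\epsilon)/\epsilon^{\beta'}=0$ for all $\beta'\in(1,\beta_0)$, $\lim_{\epsilon\downarrow0}\pi(\epsilon)/\epsilon^{\beta''}=\infty$ for all $\beta''>\beta_0$, and $\lim_{\epsilon\downarrow0}\pi(\epsilon)/\epsilon^{\beta_0}$ exists and is $0$ or $\infty$. (a) If $\beta_0\in(1,2)$, or $\beta_0=2$ and $\lim_{\epsilon\downarrow0}\pi(\epsilon)/\epsilon^2=\infty$, then $$U_\epsilon(r_\epsilon)=-\frac2q(\beta_0-1)\log\frac1\epsilon+\frac2q\log\frac{\pi(\epsilon)}{\epsilon^{\beta_0}}+\frac2q\log\sqrt{\frac{qA}{2g(R)}}+o_\epsilon(1),$$ $$U_\epsilon'(r_\epsilon)=-\frac{2}{q\,\pi(\epsilon)}(1+o_\epsilon(1)),\qquad \rho_\epsilon(r_\epsilon)=\frac{2g(R)}{q}\Big(\frac{\epsilon}{\pi(\epsilon)}\Big)^2(1+o_\epsilon(1)).$$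 Moreover, the absolute values of the first two terms of the expansion of $U_\epsilon(r_\epsilon)$ tend to $\infty$, and $\log\frac{\pi(\epsilon)}{\epsilon^{\beta_0}}=o_\epsilon(1)\log\frac1\epsilon$. (b) If $\beta_0>2$, or $\beta_0=2$ and $\lim_{\epsilon\downarrow0}\pi(\epsilon)/\epsilon^2=0$, then $$U_\epsilon(r_\epsilon)=-\frac2q\log\frac1\epsilon+\frac2q\log\left[\sqrt{\frac{A}{2qg(R)}}\;\frac{2Ng(R)}{R(B-A)}\right]+o_\epsilon(1),$$ $$U_\epsilon'(r_\epsilon)=-\frac{R(B-A)}{Ng(R)}\epsilon^{-2}(1+o_\epsilon(1)),\qquad \rho_\epsilon(r_\epsilon)=\frac{qR^2(B-A)^2}{2N^2g(R)}\epsilon^{-2}(1+o_\epsilon(1)).$$ **(II)** Let $\Theta\in(0,1)$, $\gamma>0$, $\tau\in\mathbb R$ and an integer $n\ge2$ be independent of $\epsilon$, let $\log^{(n)}$ be the $n$-fold iterate of the natural logarithm, and put $$\kappa(\epsilon)=1-\Big(\log\frac1\epsilon\Big)^{-\Theta},\quad \beta_1(\epsilon)=1+\gamma\Big(\log\frac1\epsilon\Big)^{-\Theta},\quad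 \beta_2(\epsilon)=1+\Big(\log\frac1\epsilon\Big)^{-1}\Big(\gamma\log^{(n)}\frac1\epsilon+\tau\Big).$$ For all fixed $\kappa\in(0,1)$ and $\beta>1$, the points $R-\epsilon^{\kappa(\epsilon)}$, $R-\epsilon^{\beta_1(\epsilon)}$ and $R-\epsilon^{\beta_2(\epsilon)}$ lie in $[R-\epsilon^{\kappa},R-\epsilon^{\beta}]$ for all sufficiently small $\epsilon>0$, and $$\lim_{\epsilon\downarrow0}|U_\epsilon(R-\epsilon^{\kappa(\epsilon)})|=\lim_{\epsilon\downarrow0}|U_\epsilon'(R-\epsilon^{\kappa(\epsilon)})|=0,$$ $$U_\epsilon(R-\epsilon^{\beta_1(\epsilon)})=-\frac{2\gamma}{q}\Big(\log\frac1\epsilon\Big)^{1-\Theta}+\frac1q\log\frac{qA}{2g(R)}+o_\epsilon(1),$$ $$U_\epsilon(R-\epsilon^{\beta_2(\epsilon)})=-\frac{2\gamma}{q}\log^{(n)}\frac1\epsilon+\frac1q\Big(-2\tau+\log\frac{qA}{2g(R)}\Big)+o_\epsilon(1),$$ $$U_\epsilon'(R-\epsilon^{\beta_1(\epsilon)})=-\frac2q\epsilon^{-\beta_1(\epsilon)}(1+o_\epsilon(1)),\qquad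 \rho_\epsilon(R-\epsilon^{\beta_1(\epsilon)})=\frac{2g(R)}{q}\epsilon^{-2(\beta_1(\epsilon)-1)}(1+o_\epsilon(1)).$$ If in addition $n=2$ and $\gamma>2$, then $$U_\epsilon'(R-\epsilon^{\beta_2(\epsilon)})=-\frac2q\epsilon^{-\beta_2(\epsilon)}(1+o_\epsilon(1)),\qquad \rho_\epsilon(R-\epsilon^{\beta_2(\epsilon)})=\frac{2g(R)}{q}\epsilon^{-2(\beta_2(\epsilon)-1)}(1+o_\epsilon(1)).$$ -/

import Mathlib

open Set Filter Topology Asymptotics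
open scoped ContDiff

namespace CCPB

/-- The net charge density `ρ(r)` of a radial potential `U` in the ball of radius `R` of `ℝ^N`. -/
noncomputable def rho (N : ℕ) (R A B p q : ℝ) (U : ℝ → ℝ) (r : ℝ) : ℝ :=
  -(R ^ N / N) *
    (A * Real.exp (p * U r) / (∫ s in (0 : ℝ)..R, s ^ (N - 1) * Real.exp (p * U s)) -
      B * Real.exp (-(q * U r)) / (∫ s in (0 : ℝ)..R, s ^ (N - 1) * Real.exp (-(q * U s))))

/-- `U ∈ C¹([0,R]) ∩ C^∞((0,R))` solves the radial non-local Neumann problem with parameter `ε`: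
the equation, the normalization of the mean, and the boundary conditions at `0` and `R`.
Values of `U` outside `[0,R]` are irrelevant. -/
structure IsNeumannSolution (N : ℕ) (R A B p q : ℝ) (g : ℝ → ℝ) (ε : ℝ) (U : ℝ → ℝ) :
    Prop where
  contDiffOn_Icc : ContDiffOn ℝ 1 U (Icc 0 R)
  contDiffOn_Ioo : ContDiffOn ℝ ∞ U (Ioo 0 R)
  equation : ∀ r ∈ Ioo 0 R,
    ε ^ 2 * g r * (deriv (deriv U) r + (((N : ℝ) - 1) / r + deriv g r / g r) * deriv U r) =
      R ^ N / N *
        (A * Real.exp (p * U r) / (∫ s in (0 : ℝ)..R, s ^ (N - 1) * Real.exp (p * U s)) -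
          B * Real.exp (-(q * U r)) / (∫ s in (0 : ℝ)..R, s ^ (N - 1) * Real.exp (-(q * U s))))
  mean_zero : ∫ s in (0 : ℝ)..R, s ^ (N - 1) * U s = 0
  neumann_zero : HasDerivWithinAt U 0 (Icc 0 R) 0
  neumann_R : HasDerivWithinAt U (R * (A - B) / (ε ^ 2 * N * g R)) (Icc 0 R) R

/-- `d(ε)` has exponential order `β₀ > 1` as `ε ↓ 0`, but is not comparable to `ε ^ β₀`. -/
structure IsNonPowerScale (β₀ : ℝ) (d : ℝ → ℝ) : Prop where
  one_lt : 1 < β₀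
  lower : ∀ β ∈ Ioo 1 β₀, Tendsto (fun ε => d ε / ε ^ β) (𝓝[>] 0) (𝓝 0)
  upper : ∀ β ∈ Ioi β₀, Tendsto (fun ε => d ε / ε ^ β) (𝓝[>] 0) atTop
  critical : Tendsto (fun ε => d ε / ε ^ β₀) (𝓝[>] 0) (𝓝 0) ∨
    Tendsto (fun ε => d ε / ε ^ β₀) (𝓝[>] 0) atTop

/-- `κ(ε) = 1 - (log (1/ε))^(-Θ)`. -/
noncomputable def kappa (Θ ε : ℝ) : ℝ := 1 - Real.log (1 / ε) ^ (-Θ)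

/-- `β₁(ε) = 1 + γ (log (1/ε))^(-Θ)`. -/
noncomputable def beta₁ (Θ γ ε : ℝ) : ℝ := 1 + γ * Real.log (1 / ε) ^ (-Θ)

/-- `β₂(ε) = 1 + (log (1/ε))⁻¹ (γ log^(n) (1/ε) + τ)`, with `log^(n)` the `n`-fold iterate of the
natural logarithm. -/
noncomputable def beta₂ (n : ℕ) (γ τ ε : ℝ) : ℝ :=
  1 + (Real.log (1 / ε))⁻¹ * (γ * Real.log^[n] (1 / ε) + τ)

end CCPB

/-! Let `U₀` be the value at which the two reaction terms balance, `M` their common size there, and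
`Z = U₀ - U`. Then `Z` solves the local equation `ε² (r^(N-1) g Z')' = r^(N-1) M (e^(qZ) - e^(-pZ))`
with `Z'(0) = 0` and `Z'(R) = K/ε²`, where `K = R(B-A)/(N g(R))`; the non-locality survives only in
the two numbers `U₀` and `M`.

A minimum principle gives `Z ≥ 0`, hence the flux `r^(N-1) g Z'` and `Z` itself are nondecreasing,
and `M ≥ A`. Integrating the equation, the factor `ε²` cancels against the boundary slope, so the
integral of the reaction is bounded uniformly in `ε`. A doubling argument on steps of length `O(ε)`
then gives exponential decay in `(R-r)/ε` (`exists_decay`). Consequently `Z → 0` in mean, and the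
two integral constraints yield `U₀ → 0` and `M → A` (`exists_layer_family`).

Near `R` the weights are almost constant, and the energy identity says that `ε Z' e^(-qZ/2)` is
almost `c = √(2A/(q g(R)))` where `Z` is large (`exists_slope_bounds`). Thus `X = e^(-qZ/2)` has
slope almost `-qc/(2ε)`, and the boundary condition gives `X(R) ≈ cε/K`; therefore `X(R-t) ≈ cε/K +
qct/(2ε)` for `t = o(ε)`. Everything is read off from `X`: `U = U₀ + (2/q) log X`, `U' ≈ -c/(εX)`
and `ρ ≈ A/X²` (`layer_asymptotics`).

The second summand dominates when `t ≫ ε²` and the first when `t ≪ ε²`, which are cases (a) and (b).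
The points with exponents `β₁`, `β₂` fall under the first regime, while at exponent `κ(ε)` the
exponential decay applies directly. -/

namespace CCPB

/-! ### The reaction term, its primitive, and mean value inequalities. -/

/-- The reaction term of the boundary layer equation, in the variable `Z = U₀ - U`. -/
noncomputable def excess (p q z : ℝ) : ℝ := Real.exp (q * z) - Real.exp (-(p * z))

/-- The primitive of `excess` that vanishes at `0`. -/
noncomputable def excessPrimitive (p q z : ℝ) : ℝ :=
  (Real.exp (q * z) - 1) / q + (Real.exp (-(p * z)) - 1) / p

/-- `Z`, with derivative `D`, solves `ε² (r^(N-1) g Z')' = r^(N-1) M (e^(qZ) - e^(-pZ))` on `(0,R)`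
with `Z'(0) = 0` and `Z'(R) = K / ε²`. -/
structure IsProfile (N : ℕ) (R p q : ℝ) (g : ℝ → ℝ) (K ε M : ℝ) (Z D : ℝ → ℝ) : Prop where
  continuousOn : ContinuousOn Z (Icc 0 R)
  continuousOn_slope : ContinuousOn D (Icc 0 R)
  hasDerivAt : ∀ r ∈ Ioo 0 R, HasDerivAt Z (D r) r
  hasDerivAt_flux : ∀ r ∈ Ioo 0 R, HasDerivAt (fun s => s ^ (N - 1) * g s * D s)
    (r ^ (N - 1) * (M * excess p q (Z r)) / ε ^ 2) r
  slope_zero : D 0 = 0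
  slope_R : D R = K / ε ^ 2

theorem excess_neg {p q z : ℝ} (hp : 0 < p) (hq : 0 < q) (hz : z < 0) : excess p q z < 0 := by
  have : q * z < -(p * z) := by nlinarith
  simpa [excess] using this

theorem mul_le_excess {p q z : ℝ} (hp : 0 < p) (hz : 0 ≤ z) : q * z ≤ excess p q z := by
  have h1 := Real.add_one_le_exp (q * z)
  have h2 : Real.exp (-(p * z)) ≤ 1 := Real.exp_le_one_iff.2 (by nlinarith)
  unfold excess; linarith

theorem excess_nonneg {p q z : ℝ} (hp : 0 < p) (hq : 0 < q) (hz : 0 ≤ z) : 0 ≤ excess p q z :=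
  (by positivity : 0 ≤ q * z).trans (mul_le_excess hp hz)

theorem sq_le_excess {p q z : ℝ} (hp : 0 < p) (hq : 0 < q) (hz : 0 ≤ z) :
    (q * z) ^ 2 / 2 ≤ excess p q z := by
  have h1 := Real.quadratic_le_exp_of_nonneg (by positivity : 0 ≤ q * z)
  have h2 : Real.exp (-(p * z)) ≤ 1 := Real.exp_le_one_iff.2 (by nlinarith)
  have : 0 ≤ q * z := by positivity
  unfold excess; linarith

theorem continuous_excess (p q : ℝ) : Continuous (excess p q) := by
  unfold excess; fun_prop

theorem hasDerivAt_excessPrimitive {p q : ℝ} (hp : 0 < p) (hq : 0 < q) (z : ℝ) :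
    HasDerivAt (excessPrimitive p q) (excess p q z) z := by
  have h1 : HasDerivAt (fun z : ℝ => Real.exp (q * z)) (Real.exp (q * z) * (q * 1)) z :=
    ((hasDerivAt_id z).const_mul q).exp
  have h2 : HasDerivAt (fun z : ℝ => Real.exp (-(p * z))) (Real.exp (-(p * z)) * (-(p * 1))) z :=
    ((hasDerivAt_id z).const_mul p).neg.exp
  refine (((h1.sub_const 1).div_const q).add ((h2.sub_const 1).div_const p)).congr_deriv ?_
  unfold excess; field_simp; ring

theorem excessPrimitive_nonneg {p q z : ℝ} (hp : 0 < p) (hq : 0 < q) :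
    0 ≤ excessPrimitive p q z := by
  have h1 : q * z / q ≤ (Real.exp (q * z) - 1) / q := by
    gcongr; linarith [Real.add_one_le_exp (q * z)]
  have h2 : -(p * z) / p ≤ (Real.exp (-(p * z)) - 1) / p := by
    gcongr; linarith [Real.add_one_le_exp (-(p * z))]
  rw [mul_div_cancel_left₀ _ hq.ne'] at h1
  rw [neg_div, mul_div_cancel_left₀ _ hp.ne'] at h2
  unfold excessPrimitive; linarith

theorem excessPrimitive_le {p q z : ℝ} (hp : 0 < p) (hq : 0 < q) (hz : 0 ≤ z) :
    excessPrimitive p q z ≤ Real.exp (q * z) / q := by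
  have h2 : Real.exp (-(p * z)) ≤ 1 := Real.exp_le_one_iff.2 (by nlinarith)
  have h3 : (Real.exp (-(p * z)) - 1) / p ≤ 0 := div_nonpos_of_nonpos_of_nonneg (by linarith) hp.le
  have h4 : (0 : ℝ) < 1 / q := by positivity
  unfold excessPrimitive; rw [sub_div]; linarith

theorem le_excessPrimitive {p q z : ℝ} (hp : 0 < p) :
    Real.exp (q * z) / q - (1 / q + 1 / p) ≤ excessPrimitive p q z := by
  have h3 : 0 ≤ Real.exp (-(p * z)) / p := by positivity
  unfold excessPrimitive; rw [sub_div, sub_div]; linarith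

/-- The derivative is required only in the open interval because the equation is available only on
`(0,R)`, whereas the estimates run up to the endpoints. -/
theorem mul_sub_le_sub_of_le_hasDerivAt {f f' : ℝ → ℝ} {a b m : ℝ} (hab : a ≤ b)
    (hc : ContinuousOn f (Icc a b)) (hd : ∀ x ∈ Ioo a b, HasDerivAt f (f' x) x)
    (hm : ∀ x ∈ Ioo a b, m ≤ f' x) : m * (b - a) ≤ f b - f a := by
  rcases hab.eq_or_lt with rfl | h
  · simp
  · obtain ⟨c, hc, he⟩ := exists_hasDerivAt_eq_slope f f' h hc hd
    have := hm c hc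
    rwa [he, le_div_iff₀ (by linarith)] at this

theorem sub_lt_zero_of_hasDerivAt_neg {f f' : ℝ → ℝ} {a b : ℝ} (hab : a < b)
    (hc : ContinuousOn f (Icc a b)) (hd : ∀ x ∈ Ioo a b, HasDerivAt f (f' x) x)
    (hm : ∀ x ∈ Ioo a b, f' x < 0) : f b < f a := by
  obtain ⟨c, hc, he⟩ := exists_hasDerivAt_eq_slope f f' hab hc hd
  have := hm c hc
  rw [he, div_neg_iff] at this
  rcases this with h | h <;> linarith

/-! ### Minimum principle, monotonicity and energy of a single profile. -/

namespace IsProfile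

variable {N : ℕ} {R p q K ε M : ℝ} {g Z D : ℝ → ℝ}

theorem continuousOn_flux (h : IsProfile N R p q g K ε M Z D) (hg : ContinuousOn g (Icc 0 R)) :
    ContinuousOn (fun s => s ^ (N - 1) * g s * D s) (Icc 0 R) :=
  ((continuousOn_id.pow _).mul hg).mul h.continuousOn_slope

/-- Minimum principle. A negative minimum cannot sit at `R`, where the slope is positive, so the
slope vanishes there, also when it sits at `0`. While `Z < 0` the flux strictly decreases from zero,
so `Z` drops further to the right, contradicting minimality. -/
theorem nonneg (h : IsProfile N R p q g K ε M Z D) (hR : 0 < R) (hp : 0 < p) (hq : 0 < q)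
    (hK : 0 < K) (hε : 0 < ε) (hM : 0 < M) (hg : ContinuousOn g (Icc 0 R))
    (hpos : ∀ r ∈ Icc 0 R, 0 < g r) : ∀ r ∈ Icc 0 R, 0 ≤ Z r := by
  obtain ⟨r₀, hr₀, hmin⟩ := isCompact_Icc.exists_isMinOn (nonempty_Icc.2 hR.le) h.continuousOn
  suffices 0 ≤ Z r₀ from fun r hr => this.trans (hmin hr)
  by_contra! hneg
  have hlt : r₀ < R := by
    refine lt_of_le_of_ne hr₀.2 ?_
    rintro rfl
    have hD : 0 < D r₀ := by rw [h.slope_R]; positivity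
    have hev : ∀ᶠ r in 𝓝[Iic r₀] r₀, 0 < D r := by
      have := (h.continuousOn_slope r₀ hr₀).eventually (lt_mem_nhds hD)
      rwa [nhdsWithin_Icc_eq_nhdsLE hR] at this
    obtain ⟨a, ha, hDa⟩ := (mem_nhdsLE_iff_exists_mem_Ico_Ioc_subset hR).1 hev
    have ha0 : 0 ≤ a := ha.1
    have := sub_lt_zero_of_hasDerivAt_neg (f := fun r => - Z r) (f' := fun r => - D r) ha.2
      (h.continuousOn.neg.mono (Icc_subset_Icc_left ha0))
      (fun x hx => (h.hasDerivAt x ⟨ha0.trans_lt hx.1, hx.2⟩).neg)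
      (fun x hx => by have : 0 < D x := hDa ⟨hx.1, hx.2.le⟩
                      linarith)
    have h2 : Z r₀ ≤ Z a := hmin ⟨ha0, ha.2.le⟩
    linarith
  have hD0 : D r₀ = 0 := by
    rcases hr₀.1.eq_or_lt with h0 | h0
    · rw [← h0, h.slope_zero]
    · exact (hmin.isLocalMin (Icc_mem_nhds h0 hlt)).hasDerivAt_eq_zero (h.hasDerivAt _ ⟨h0, hlt⟩)
  have hev : ∀ᶠ r in 𝓝[Ici r₀] r₀, Z r < 0 := by
    have h1 : ContinuousWithinAt Z (Icc r₀ R) r₀ :=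
      (h.continuousOn r₀ hr₀).mono (Icc_subset_Icc_left hr₀.1)
    have h2 := h1.eventually (gt_mem_nhds hneg)
    rwa [nhdsWithin_Icc_eq_nhdsGE hlt] at h2
  obtain ⟨b, hb, hZb⟩ := (mem_nhdsGE_iff_exists_mem_Ioc_Ico_subset hlt).1 hev
  have hbR : b ≤ R := hb.2
  have hDneg : ∀ x ∈ Ioo r₀ b, D x < 0 := by
    intro x hx
    have hw := sub_lt_zero_of_hasDerivAt_neg hx.1
      ((h.continuousOn_flux hg).mono (Icc_subset_Icc hr₀.1 (hx.2.le.trans hbR)))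
      (fun y hy => h.hasDerivAt_flux y ⟨hr₀.1.trans_lt hy.1, hy.2.trans (hx.2.trans_le hbR)⟩)
      (fun y hy => by
        have hy0 : 0 < y := hr₀.1.trans_lt hy.1
        have hZy : Z y < 0 := hZb ⟨hy.1.le, hy.2.trans hx.2⟩
        have := excess_neg hp hq hZy
        have h3 : y ^ (N - 1) * (M * excess p q (Z y)) < 0 :=
          mul_neg_of_pos_of_neg (by positivity) (mul_neg_of_pos_of_neg hM this)
        exact div_neg_of_neg_of_pos h3 (by positivity))
    simp only [hD0, mul_zero] at hw
    have hx0 : 0 < x := hr₀.1.trans_lt hx.1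
    have := hpos x ⟨hx0.le, hx.2.le.trans hbR⟩
    by_contra! hc
    have : 0 ≤ x ^ (N - 1) * g x * D x := by positivity
    linarith
  have hlast := sub_lt_zero_of_hasDerivAt_neg hb.1
    (h.continuousOn.mono (Icc_subset_Icc hr₀.1 hbR))
    (fun y hy => h.hasDerivAt y ⟨hr₀.1.trans_lt hy.1, hy.2.trans_le hbR⟩) hDneg
  have h2 : Z r₀ ≤ Z b := hmin ⟨hr₀.1.trans hb.1.le, hbR⟩
  linarith

theorem flux_mono (h : IsProfile N R p q g K ε M Z D) (hp : 0 < p) (hq : 0 < q)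
    (hM : 0 < M) (hg : ContinuousOn g (Icc 0 R)) (hZ : ∀ r ∈ Icc 0 R, 0 ≤ Z r) :
    MonotoneOn (fun s => s ^ (N - 1) * g s * D s) (Icc 0 R) := by
  intro a ha b hb hab
  have := mul_sub_le_sub_of_le_hasDerivAt (m := 0) hab
    ((h.continuousOn_flux hg).mono (Icc_subset_Icc ha.1 hb.2))
    (fun y hy => h.hasDerivAt_flux y ⟨ha.1.trans_lt hy.1, hy.2.trans_le hb.2⟩)
    (fun y hy => by
      have hy0 : 0 < y := ha.1.trans_lt hy.1
      have := excess_nonneg hp hq (hZ y ⟨hy0.le, (hy.2.trans_le hb.2).le⟩)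
      positivity)
  simp only [zero_mul, sub_nonneg] at this
  exact this

theorem slope_nonneg (h : IsProfile N R p q g K ε M Z D) (hR : 0 < R) (hp : 0 < p) (hq : 0 < q)
    (hM : 0 < M) (hg : ContinuousOn g (Icc 0 R)) (hpos : ∀ r ∈ Icc 0 R, 0 < g r)
    (hZ : ∀ r ∈ Icc 0 R, 0 ≤ Z r) : ∀ r ∈ Icc 0 R, 0 ≤ D r := by
  intro r hr
  rcases hr.1.eq_or_lt with h0 | h0
  · rw [← h0, h.slope_zero]
  · have h1 := h.flux_mono hp hq hM hg hZ (left_mem_Icc.2 hR.le) hr hr.1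
    simp only [h.slope_zero, mul_zero] at h1
    have := hpos r hr
    by_contra! hc
    have : r ^ (N - 1) * g r * D r < 0 := mul_neg_of_pos_of_neg (by positivity) hc
    linarith

theorem mono (h : IsProfile N R p q g K ε M Z D) (hD : ∀ r ∈ Icc 0 R, 0 ≤ D r) :
    MonotoneOn Z (Icc 0 R) := by
  intro a ha b hb hab
  have := mul_sub_le_sub_of_le_hasDerivAt (m := 0) hab
    (h.continuousOn.mono (Icc_subset_Icc ha.1 hb.2))
    (fun y hy => h.hasDerivAt y ⟨ha.1.trans_lt hy.1, hy.2.trans_le hb.2⟩)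
    (fun y hy => hD y ⟨ha.1.trans hy.1.le, hy.2.le.trans hb.2⟩)
  linarith

/-- Multiplying the equation by the flux makes both terms derivatives, except for the weight
`(r^(N-1))² g`. Replacing that weight by a constant `m` leaves a derivative with the sign of weight
minus `m`, so lower and upper bounds of the weight give the two one-sided energy estimates. -/
theorem hasDerivAt_energy (h : IsProfile N R p q g K ε M Z D) (hε : 0 < ε) (hp : 0 < p)
    (hq : 0 < q) (m : ℝ) {r : ℝ} (hr : r ∈ Ioo 0 R) :
    HasDerivAt (fun s => ε ^ 2 * (s ^ (N - 1) * g s * D s) ^ 2 / 2 -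
        m * (M * excessPrimitive p q (Z s)))
      (((r ^ (N - 1)) ^ 2 * g r - m) * (M * excess p q (Z r) * D r)) r := by
  have h1 := (((h.hasDerivAt_flux r hr).pow 2).const_mul (ε ^ 2)).div_const 2
  have h2 := (((hasDerivAt_excessPrimitive hp hq (Z r)).comp r (h.hasDerivAt r hr)).const_mul
    M).const_mul m
  refine (h1.sub h2).congr_deriv ?_
  field_simp
  ring

theorem continuousOn_energy (h : IsProfile N R p q g K ε M Z D) (hp : 0 < p) (hq : 0 < q)
    (hg : ContinuousOn g (Icc 0 R)) (m : ℝ) :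
    ContinuousOn (fun s => ε ^ 2 * (s ^ (N - 1) * g s * D s) ^ 2 / 2 -
        m * (M * excessPrimitive p q (Z s))) (Icc 0 R) := by
  have hG : Continuous (excessPrimitive p q) :=
    continuous_iff_continuousAt.2 fun z => (hasDerivAt_excessPrimitive hp hq z).continuousAt
  exact ((((h.continuousOn_flux hg).pow 2).const_smul (ε ^ 2)).div_const 2).sub
    (((hG.comp_continuousOn h.continuousOn).const_smul M).const_smul m)

theorem le_energy_sub (h : IsProfile N R p q g K ε M Z D) (hε : 0 < ε) (hp : 0 < p)
    (hq : 0 < q) (hM : 0 < M) (hg : ContinuousOn g (Icc 0 R)) (hZ : ∀ r ∈ Icc 0 R, 0 ≤ Z r)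
    (hD : ∀ r ∈ Icc 0 R, 0 ≤ D r) {a b m : ℝ} (ha : 0 ≤ a) (hab : a ≤ b) (hb : b ≤ R)
    (hm : ∀ r ∈ Icc a b, m ≤ (r ^ (N - 1)) ^ 2 * g r) :
    m * (M * (excessPrimitive p q (Z b) - excessPrimitive p q (Z a))) ≤
      ε ^ 2 * (b ^ (N - 1) * g b * D b) ^ 2 / 2 - ε ^ 2 * (a ^ (N - 1) * g a * D a) ^ 2 / 2 := by
  have := mul_sub_le_sub_of_le_hasDerivAt (m := 0) hab
    ((h.continuousOn_energy hp hq hg m).mono (Icc_subset_Icc ha hb))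
    (fun y hy => h.hasDerivAt_energy hε hp hq m ⟨ha.trans_lt hy.1, hy.2.trans_le hb⟩)
    (fun y hy => by
      have hy' : y ∈ Icc 0 R := ⟨ha.trans hy.1.le, hy.2.le.trans hb⟩
      have h1 := excess_nonneg hp hq (hZ y hy')
      have h2 := hD y hy'
      have h3 := sub_nonneg.2 (hm y ⟨hy.1.le, hy.2.le⟩)
      positivity)
  linarith

theorem energy_sub_le (h : IsProfile N R p q g K ε M Z D) (hε : 0 < ε) (hp : 0 < p)
    (hq : 0 < q) (hM : 0 < M) (hg : ContinuousOn g (Icc 0 R)) (hZ : ∀ r ∈ Icc 0 R, 0 ≤ Z r)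
    (hD : ∀ r ∈ Icc 0 R, 0 ≤ D r) {a b m : ℝ} (ha : 0 ≤ a) (hab : a ≤ b) (hb : b ≤ R)
    (hm : ∀ r ∈ Icc a b, (r ^ (N - 1)) ^ 2 * g r ≤ m) :
    ε ^ 2 * (b ^ (N - 1) * g b * D b) ^ 2 / 2 - ε ^ 2 * (a ^ (N - 1) * g a * D a) ^ 2 / 2 ≤
      m * (M * (excessPrimitive p q (Z b) - excessPrimitive p q (Z a))) := by
  have := mul_sub_le_sub_of_le_hasDerivAt (m := 0) hab
    ((h.continuousOn_energy hp hq hg m).neg.mono (Icc_subset_Icc ha hb))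
    (fun y hy => (h.hasDerivAt_energy hε hp hq m ⟨ha.trans_lt hy.1, hy.2.trans_le hb⟩).neg)
    (fun y hy => by
      have hy' : y ∈ Icc 0 R := ⟨ha.trans hy.1.le, hy.2.le.trans hb⟩
      have h1 := excess_nonneg hp hq (hZ y hy')
      have h2 := hD y hy'
      have h3 := sub_nonneg.2 (hm y ⟨hy.1.le, hy.2.le⟩)
      rw [← neg_mul, neg_sub]
      positivity)
  simp only [Pi.neg_apply] at this
  linarith

/-- The flux gained on an interval controls the values of the profile. -/
theorem mul_le_flux_sub (h : IsProfile N R p q g K ε M Z D) (hp : 0 < p)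
    (hq : 0 < q) {A : ℝ} (hA : 0 < A) (hAM : A ≤ M) (hg : ContinuousOn g (Icc 0 R))
    (hZ : ∀ r ∈ Icc 0 R, 0 ≤ Z r) (hmono : MonotoneOn Z (Icc 0 R)) {a b : ℝ} (ha : 0 ≤ a)
    (hab : a ≤ b) (hb : b ≤ R) :
    a ^ (N - 1) * (A * (q * Z a)) / ε ^ 2 * (b - a) ≤
      b ^ (N - 1) * g b * D b - a ^ (N - 1) * g a * D a := by
  refine mul_sub_le_sub_of_le_hasDerivAt hab
    ((h.continuousOn_flux hg).mono (Icc_subset_Icc ha hb))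
    (fun y hy => h.hasDerivAt_flux y ⟨ha.trans_lt hy.1, hy.2.trans_le hb⟩) (fun y hy => ?_)
  have ha' : a ∈ Icc 0 R := ⟨ha, hab.trans hb⟩
  have hy' : y ∈ Icc 0 R := ⟨ha.trans hy.1.le, hy.2.le.trans hb⟩
  have h0 := hZ a ha'
  have h1 := hmono ha' hy' hy.1.le
  have h2 : q * Z a ≤ excess p q (Z y) :=
    (mul_le_mul_of_nonneg_left h1 hq.le).trans (mul_le_excess hp (hZ y hy'))
  have h3 : 0 ≤ q * Z a := by positivity
  have h4 := hy.1.le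
  have h5 : 0 ≤ y ^ (N - 1) := pow_nonneg hy'.1 _
  have h6 : 0 ≤ M := hA.le.trans hAM
  gcongr

end IsProfile
-- Decay away from the boundary, uniform in the parameter.
/-- The data of the boundary layer problem that do not depend on `ε`. -/
structure IsLayerData (R p q A K : ℝ) (g : ℝ → ℝ) : Prop where
  R_pos : 0 < R
  p_pos : 0 < p
  q_pos : 0 < q
  A_pos : 0 < A
  K_pos : 0 < K
  continuousOn : ContinuousOn g (Icc 0 R)
  g_pos : ∀ r ∈ Icc 0 R, 0 < g r

/-- A nonnegative nondecreasing profile whose coefficient `M` is at least `A`. -/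
structure IsLayer (N : ℕ) (R p q A : ℝ) (g : ℝ → ℝ) (K ε M : ℝ) (Z D : ℝ → ℝ) : Prop extends
    IsProfile N R p q g K ε M Z D where
  ε_pos : 0 < ε
  le_M : A ≤ M
  nonneg : ∀ r ∈ Icc 0 R, 0 ≤ Z r
  slope_nonneg : ∀ r ∈ Icc 0 R, 0 ≤ D r

namespace IsLayer

variable {N : ℕ} {R p q A K ε M : ℝ} {g Z D : ℝ → ℝ}

theorem monotoneOn (h : IsLayer N R p q A g K ε M Z D) : MonotoneOn Z (Icc 0 R) :=
  h.toIsProfile.mono h.slope_nonneg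

/-- The flux gained between `r` and `R` is at most the flux at `R`; both sides carry `1/ε²`, which
cancels and leaves a bound independent of `ε`. -/
theorem mul_le_total (h : IsLayer N R p q A g K ε M Z D) (d : IsLayerData R p q A K g) {r : ℝ}
    (hr : r ∈ Icc 0 R) :
    r ^ (N - 1) * (A * (q * Z r)) * (R - r) ≤ R ^ (N - 1) * g R * K := by
  have h1 := h.mul_le_flux_sub d.p_pos d.q_pos d.A_pos h.le_M d.continuousOn h.nonneg h.monotoneOn
    hr.1 hr.2 le_rfl
  have h2 : 0 ≤ r ^ (N - 1) * g r * D r :=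
    mul_nonneg (mul_nonneg (pow_nonneg hr.1 _) (d.g_pos r hr).le) (h.slope_nonneg r hr)
  have hε := h.ε_pos
  rw [h.slope_R] at h1
  have h3 : r ^ (N - 1) * (A * (q * Z r)) / ε ^ 2 * (R - r) ≤ R ^ (N - 1) * g R * (K / ε ^ 2) := by
    linarith
  have h4 := mul_le_mul_of_nonneg_right h3 (by positivity : 0 ≤ ε ^ 2)
  field_simp at h4
  linarith

/-- On a first step of length `l ε` the reaction raises the flux enough to force slope at least `Z r
/ (l ε)`; a second step of the same length then adds at least `Z r`. -/
theorem two_mul_le (h : IsLayer N R p q A g K ε M Z D) (d : IsLayerData R p q A K g) {l G : ℝ}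
    (hl : 0 < l) (hG : ∀ r ∈ Icc 0 R, g r ≤ G)
    (hlG : R ^ (N - 1) * G ≤ (R / 2) ^ (N - 1) * (A * q) * l ^ 2) {r : ℝ} (hr : R / 2 ≤ r)
    (hrl : r + 2 * (l * ε) ≤ R) : 2 * Z r ≤ Z (r + 2 * (l * ε)) := by
  have hR := d.R_pos
  have hε := h.ε_pos
  have hle : 0 < l * ε := by positivity
  have hr0 : 0 < r := by linarith
  have hG0 : 0 < G := (d.g_pos R ⟨hR.le, le_rfl⟩).trans_le (hG R ⟨hR.le, le_rfl⟩)
  have hZr := h.nonneg r ⟨hr0.le, by linarith⟩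
  have hA := d.A_pos
  have hq := d.q_pos
  have h1 := h.mul_le_flux_sub d.p_pos d.q_pos d.A_pos h.le_M d.continuousOn h.nonneg h.monotoneOn
    hr0.le (by linarith : r ≤ r + l * ε) (by linarith)
  have h2 : 0 ≤ r ^ (N - 1) * g r * D r :=
    mul_nonneg (mul_nonneg (pow_nonneg hr0.le _) (d.g_pos r ⟨hr0.le, by linarith⟩).le)
      (h.slope_nonneg r ⟨hr0.le, by linarith⟩)
  have h3 : ∀ s ∈ Ioo (r + l * ε) (r + 2 * (l * ε)), Z r / (l * ε) ≤ D s := by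
    intro s hs
    have hs0 : 0 < s := by linarith [hs.1]
    have hs' : s ∈ Icc 0 R := ⟨hs0.le, by linarith [hs.2]⟩
    have h4 : (r + l * ε) ^ (N - 1) * g (r + l * ε) * D (r + l * ε) ≤ s ^ (N - 1) * g s * D s :=
      h.toIsProfile.flux_mono d.p_pos d.q_pos (hA.trans_le h.le_M) d.continuousOn h.nonneg
        ⟨by linarith, by linarith⟩ hs' hs.1.le
    have hDs := h.slope_nonneg s hs'
    have h5 : s ^ (N - 1) * g s * D s ≤ R ^ (N - 1) * G * D s := by
      have := hs'.2
      have := hG s hs'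
      have := d.g_pos s hs'
      gcongr
    have h6 : (R / 2) ^ (N - 1) * (A * (q * Z r)) ≤ r ^ (N - 1) * (A * (q * Z r)) := by gcongr
    have h7 : (R / 2) ^ (N - 1) * (A * (q * Z r)) / ε ^ 2 * (l * ε) ≤ R ^ (N - 1) * G * D s := by
      have : (R / 2) ^ (N - 1) * (A * (q * Z r)) / ε ^ 2 * (l * ε) ≤
        r ^ (N - 1) * (A * (q * Z r)) / ε ^ 2 * (r + l * ε - r) := by
        rw [add_sub_cancel_left]; gcongr
      linarith
    have h8 := mul_le_mul_of_nonneg_right hlG (by positivity : 0 ≤ Z r / (l * ε))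
    have h9 : (R / 2) ^ (N - 1) * (A * q) * l ^ 2 * (Z r / (l * ε)) =
      (R / 2) ^ (N - 1) * (A * (q * Z r)) / ε ^ 2 * (l * ε) := by field_simp
    exact le_of_mul_le_mul_left ((h8.trans_eq h9).trans h7) (by positivity)
  have h4 := mul_sub_le_sub_of_le_hasDerivAt (by linarith)
    (h.continuousOn.mono (Icc_subset_Icc (by linarith) hrl))
    (fun y hy => h.hasDerivAt y ⟨by linarith [hy.1], by linarith [hy.2]⟩) h3
  have h5 : Z r / (l * ε) * (r + 2 * (l * ε) - (r + l * ε)) = Z r := by field_simp; ring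
  have h6 := h.monotoneOn ⟨hr0.le, by linarith⟩ ⟨by linarith, by linarith⟩
    (by linarith : r ≤ r + l * ε)
  linarith

theorem two_pow_mul_le (h : IsLayer N R p q A g K ε M Z D) (d : IsLayerData R p q A K g) {l G : ℝ}
    (hl : 0 < l) (hG : ∀ r ∈ Icc 0 R, g r ≤ G)
    (hlG : R ^ (N - 1) * G ≤ (R / 2) ^ (N - 1) * (A * q) * l ^ 2) (n : ℕ) {r : ℝ} (hr : R / 2 ≤ r)
    (hrl : r + n * (2 * (l * ε)) ≤ R) : 2 ^ n * Z r ≤ Z (r + n * (2 * (l * ε))) := by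
  have hε := h.ε_pos
  have hle : 0 < l * ε := by positivity
  induction n with
  | zero => simp
  | succ n ih =>
    push_cast at hrl ⊢
    have h0 : 0 ≤ n * (2 * (l * ε)) := by positivity
    have h1 := ih (by linarith)
    have h2 := h.two_mul_le d hl hG hlG (r := r + n * (2 * (l * ε))) (by linarith) (by linarith)
    rw [pow_succ]
    calc 2 ^ n * 2 * Z r = 2 * (2 ^ n * Z r) := by ring
      _ ≤ _ := by linarith
      _ ≤ _ := h2
      _ = _ := by ring_nf

end IsLayer

variable {R p q A K : ℝ} {g : ℝ → ℝ}

theorem IsLayerData.exists_le (d : IsLayerData R p q A K g) :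
    ∃ G, 0 < G ∧ ∀ r ∈ Icc 0 R, g r ≤ G := by
  obtain ⟨G, hG⟩ := isCompact_Icc.bddAbove_image d.continuousOn
  have h : ∀ r ∈ Icc 0 R, g r ≤ G := fun r hr => hG (mem_image_of_mem g hr)
  have hR : R ∈ Icc 0 R := ⟨d.R_pos.le, le_rfl⟩
  exact ⟨G, (d.g_pos R hR).trans_le (h R hR), h⟩

theorem IsLayerData.exists_ge (d : IsLayerData R p q A K g) :
    ∃ G, 0 < G ∧ ∀ r ∈ Icc 0 R, G ≤ g r := by
  obtain ⟨x, hx, hmin⟩ := isCompact_Icc.exists_isMinOn (nonempty_Icc.2 d.R_pos.le) d.continuousOn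
  exact ⟨g x, d.g_pos x hx, fun r hr => hmin hr⟩

/-- Exponential decay of the profile away from the boundary, uniformly in `ε`. -/
theorem IsLayerData.exists_decay (d : IsLayerData R p q A K g) (N : ℕ) :
    ∃ C > 0, ∃ σ > 0, ∀ (ε M : ℝ) (Z D : ℝ → ℝ), IsLayer N R p q A g K ε M Z D →
      ∀ t ∈ Ioc 0 (R / 2), Z (R - t) ≤ C / t * Real.exp (-(σ * t / ε)) := by
  obtain ⟨G, hG0, hG⟩ := d.exists_le
  have hR := d.R_pos
  have hA := d.A_pos
  have hq := d.q_pos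
  have hK := d.K_pos
  have hgR := d.g_pos R ⟨hR.le, le_rfl⟩
  -- The value of `l` for which the hypothesis of the doubling lemma is an equality.
  set l := Real.sqrt (R ^ (N - 1) * G / ((R / 2) ^ (N - 1) * (A * q))) with hl_def
  have hl : 0 < l := Real.sqrt_pos.2 (by positivity)
  have hlG : R ^ (N - 1) * G ≤ (R / 2) ^ (N - 1) * (A * q) * l ^ 2 := by
    rw [hl_def, Real.sq_sqrt (by positivity)]
    field_simp
    exact le_rfl
  refine ⟨4 * (R ^ (N - 1) * g R * K) / ((R / 2) ^ (N - 1) * (A * q)), by positivity,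
    Real.log 2 / (4 * l), div_pos (Real.log_pos one_lt_two) (by positivity), ?_⟩
  intro ε M Z D h t ht
  have hε := h.ε_pos
  have ht0 := ht.1
  have ht2 := ht.2
  -- About `x` doublings of length `2 l ε` fit between `R - t` and `R - t / 2`; the remaining
  -- distance `t / 2` is kept for the bound of `mul_le_total` at `R - t / 2`.
  set x := t / (4 * (l * ε)) with hx
  set n := ⌊x⌋₊ with hn
  have hx0 : 0 ≤ x := by positivity
  have hnx : (n : ℝ) ≤ x := Nat.floor_le hx0
  have hnx' : x - 1 ≤ n := by linarith [Nat.lt_floor_add_one x]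
  have hstep : n * (2 * (l * ε)) ≤ t / 2 := by
    calc n * (2 * (l * ε)) ≤ x * (2 * (l * ε)) := by gcongr
      _ = t / 2 := by rw [hx]; field_simp; ring
  have h1 := h.two_pow_mul_le d hl hG hlG n (r := R - t) (by linarith) (by linarith)
  have h2 := h.monotoneOn (a := R - t + n * (2 * (l * ε))) (b := R - t / 2)
    ⟨by have : 0 ≤ n * (2 * (l * ε)) := by positivity
        linarith, by linarith⟩ ⟨by linarith, by linarith⟩ (by linarith)
  have h3 := h.mul_le_total d (r := R - t / 2) ⟨by linarith, by linarith⟩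
  have hZ := h.nonneg (R - t / 2) ⟨by linarith, by linarith⟩
  have hZt := h.nonneg (R - t) ⟨by linarith, by linarith⟩
  have h4 : (R / 2) ^ (N - 1) * (A * (q * Z (R - t / 2))) * (t / 2) ≤ R ^ (N - 1) * g R * K := by
    refine le_trans ?_ h3
    rw [sub_sub_cancel]
    have : R / 2 ≤ R - t / 2 := by linarith
    gcongr
  have h5 : Z (R - t / 2) ≤ 2 * (R ^ (N - 1) * g R * K) / ((R / 2) ^ (N - 1) * (A * q)) / t := by
    rw [le_div_iff₀ ht0, le_div_iff₀ (by positivity)]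
    linarith
  -- Rounding `x` down to `n` costs at most one doubling, hence the factor `1 / 2`.
  have h6 : Real.exp (Real.log 2 / (4 * l) * t / ε) / 2 ≤ 2 ^ n := by
    have e1 : Real.log 2 / (4 * l) * t / ε = Real.log 2 * x := by rw [hx]; field_simp
    have e2 : (2 : ℝ) ^ n = Real.exp (Real.log 2 * n) := by
      rw [mul_comm, Real.exp_nat_mul, Real.exp_log two_pos]
    have e3 : Real.exp (Real.log 2 * x) / 2 = Real.exp (Real.log 2 * (x - 1)) := by
      rw [mul_sub, mul_one, Real.exp_sub, Real.exp_log two_pos]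
    rw [e1, e2, e3]
    have := Real.log_pos one_lt_two
    gcongr
  rw [Real.exp_neg, ← div_eq_mul_inv, le_div_iff₀ (Real.exp_pos _)]
  have h7 : Z (R - t) * (Real.exp (Real.log 2 / (4 * l) * t / ε) / 2) ≤ Z (R - t) * 2 ^ n := by
    gcongr
  have h8 : 4 * (R ^ (N - 1) * g R * K) / ((R / 2) ^ (N - 1) * (A * q)) / t =
    2 * (2 * (R ^ (N - 1) * g R * K) / ((R / 2) ^ (N - 1) * (A * q)) / t) := by ring
  rw [h8]
  linarith

/-- As the flux is monotone, the slope on `[R - t, R - t / 2]` is at least a constant times `D (R -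
t)`. Hence `t D (R - t)` is controlled by `Z (R - t / 2)`, which decays; halving `t` halves the rate
`σ`. -/
theorem IsLayerData.exists_slope_decay (d : IsLayerData R p q A K g) (N : ℕ) :
    ∃ C > 0, ∃ σ > 0, ∀ (ε M : ℝ) (Z D : ℝ → ℝ), IsLayer N R p q A g K ε M Z D →
      ∀ t ∈ Ioc 0 (R / 2), D (R - t) ≤ C / t ^ 2 * Real.exp (-(σ * t / ε)) := by
  obtain ⟨G, hG0, hG⟩ := d.exists_le
  obtain ⟨G', hG0', hG'⟩ := d.exists_ge
  obtain ⟨C, hC, σ, hσ, hdec⟩ := d.exists_decay N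
  have hR := d.R_pos
  refine ⟨4 * C * (R ^ (N - 1) * G) / ((R / 2) ^ (N - 1) * G'), by positivity, σ / 2,
    by positivity, ?_⟩
  intro ε M Z D h t ht
  have ht0 := ht.1
  have ht2 := ht.2
  have h1 := hdec ε M Z D h (t / 2) ⟨by linarith, by linarith⟩
  have hDt := h.slope_nonneg (R - t) ⟨by linarith, by linarith⟩
  have h3 : ∀ s ∈ Ioo (R - t) (R - t / 2),
      (R / 2) ^ (N - 1) * G' * D (R - t) / (R ^ (N - 1) * G) ≤ D s := by
    intro s hs
    have hs' : s ∈ Icc 0 R := ⟨by linarith [hs.1], by linarith [hs.2]⟩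
    have h4 : (R - t) ^ (N - 1) * g (R - t) * D (R - t) ≤ s ^ (N - 1) * g s * D s :=
      h.toIsProfile.flux_mono d.p_pos d.q_pos (d.A_pos.trans_le h.le_M) d.continuousOn h.nonneg
        ⟨by linarith, by linarith⟩ hs' hs.1.le
    have hDs := h.slope_nonneg s hs'
    have h5 : s ^ (N - 1) * g s * D s ≤ R ^ (N - 1) * G * D s := by
      have := hs'.1
      have := hs'.2
      have := hG s hs'
      have := d.g_pos s hs'
      gcongr
    have h6 : (R / 2) ^ (N - 1) * G' * D (R - t) ≤ (R - t) ^ (N - 1) * g (R - t) * D (R - t) := by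
      have := hG' (R - t) ⟨by linarith, by linarith⟩
      have : R / 2 ≤ R - t := by linarith
      have : 0 ≤ (R - t) ^ (N - 1) := pow_nonneg (by linarith) _
      gcongr
    rw [div_le_iff₀ (by positivity)]
    linarith
  have h4 := mul_sub_le_sub_of_le_hasDerivAt (by linarith)
    (h.continuousOn.mono (Icc_subset_Icc (by linarith) (by linarith)))
    (fun y hy => h.hasDerivAt y ⟨by linarith [hy.1], by linarith [hy.2]⟩) h3
  have h5 := h.nonneg (R - t) ⟨by linarith, by linarith⟩
  have h6 : (R / 2) ^ (N - 1) * G' * D (R - t) / (R ^ (N - 1) * G) * (t / 2) ≤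
      C / (t / 2) * Real.exp (-(σ * (t / 2) / ε)) := by
    have : R - t / 2 - (R - t) = t / 2 := by ring
    rw [this] at h4
    linarith
  have h7 : σ / 2 * t / ε = σ * (t / 2) / ε := by ring
  rw [h7]
  set E := Real.exp (-(σ * (t / 2) / ε))
  have h8 := mul_le_mul_of_nonneg_right h6
    (by positivity : 0 ≤ R ^ (N - 1) * G / ((R / 2) ^ (N - 1) * G') * (2 / t))
  calc D (R - t) = (R / 2) ^ (N - 1) * G' * D (R - t) / (R ^ (N - 1) * G) * (t / 2) *
        (R ^ (N - 1) * G / ((R / 2) ^ (N - 1) * G') * (2 / t)) := by field_simp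
    _ ≤ _ := h8
    _ = _ := by field_simp; ring

theorem eventually_pos_nhdsGT : ∀ᶠ ε : ℝ in 𝓝[>] 0, 0 < ε := eventually_mem_nhdsWithin

theorem tendsto_exp_neg_div_nhdsGT {a : ℝ} (ha : 0 < a) :
    Tendsto (fun ε : ℝ => Real.exp (-(a / ε))) (𝓝[>] 0) (𝓝 0) := by
  refine Real.tendsto_exp_neg_atTop_nhds_zero.comp ?_
  exact (tendsto_inv_nhdsGT_zero.const_mul_atTop ha).congr fun x => (div_eq_mul_inv _ _).symm

namespace IsLayerData

variable {N : ℕ} {R p q A K : ℝ} {g : ℝ → ℝ} {M : ℝ → ℝ} {Z D : ℝ → ℝ → ℝ}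

theorem tendsto_interior (d : IsLayerData R p q A K g)
    (hL : ∀ ε, 0 < ε → IsLayer N R p q A g K ε (M ε) (Z ε) (D ε)) {t : ℝ}
    (ht : t ∈ Ioc 0 (R / 2)) : Tendsto (fun ε => Z ε (R - t)) (𝓝[>] 0) (𝓝 0) := by
  obtain ⟨C, -, σ, hσ, h⟩ := d.exists_decay N
  have ht0 := ht.1
  have ht2 := ht.2
  have h1 : Tendsto (fun ε => C / t * Real.exp (-(σ * t / ε))) (𝓝[>] 0) (𝓝 0) := by
    simpa using (tendsto_exp_neg_div_nhdsGT (by positivity : 0 < σ * t)).const_mul (C / t)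
  refine squeeze_zero' ?_ ?_ h1
  · filter_upwards [eventually_pos_nhdsGT] with ε hε
    exact (hL ε hε).nonneg _ ⟨by linarith, by linarith⟩
  · filter_upwards [eventually_pos_nhdsGT] with ε hε
    exact h _ _ _ _ (hL ε hε) t ht

theorem tendsto_slope_interior (d : IsLayerData R p q A K g)
    (hL : ∀ ε, 0 < ε → IsLayer N R p q A g K ε (M ε) (Z ε) (D ε)) {t : ℝ}
    (ht : t ∈ Ioc 0 (R / 2)) : Tendsto (fun ε => D ε (R - t)) (𝓝[>] 0) (𝓝 0) := by
  obtain ⟨C, -, σ, hσ, h⟩ := d.exists_slope_decay N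
  have ht0 := ht.1
  have ht2 := ht.2
  have h1 : Tendsto (fun ε => C / t ^ 2 * Real.exp (-(σ * t / ε))) (𝓝[>] 0) (𝓝 0) := by
    simpa using (tendsto_exp_neg_div_nhdsGT (by positivity : 0 < σ * t)).const_mul (C / t ^ 2)
  refine squeeze_zero' ?_ ?_ h1
  · filter_upwards [eventually_pos_nhdsGT] with ε hε
    exact (hL ε hε).slope_nonneg _ ⟨by linarith, by linarith⟩
  · filter_upwards [eventually_pos_nhdsGT] with ε hε
    exact h _ _ _ _ (hL ε hε) t ht

end IsLayerData

/-! ### Convergence to zero in mean. -/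

namespace IsLayer

variable {N : ℕ} {R p q A K ε M : ℝ} {g Z D : ℝ → ℝ}

theorem integral_excess_le (h : IsLayer N R p q A g K ε M Z D) (d : IsLayerData R p q A K g)
    {a : ℝ} (ha : a ∈ Icc 0 R) :
    A * ∫ s in a..R, s ^ (N - 1) * excess p q (Z s) ≤ R ^ (N - 1) * g R * K := by
  have hε := h.ε_pos
  have hsub : Icc a R ⊆ Icc 0 R := Icc_subset_Icc_left ha.1
  have hc : ContinuousOn (fun s => s ^ (N - 1) * excess p q (Z s)) (Icc a R) :=
    (continuousOn_id.pow _).mul ((continuous_excess p q).comp_continuousOn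
      (h.continuousOn.mono hsub))
  have h1 := intervalIntegral.integral_eq_sub_of_hasDerivAt_of_le ha.2
    ((h.continuousOn_flux d.continuousOn).mono hsub)
    (fun y hy => h.hasDerivAt_flux y ⟨ha.1.trans_lt hy.1, hy.2⟩) (by
      refine ContinuousOn.intervalIntegrable ?_
      rw [uIcc_of_le ha.2]
      refine ((hc.const_smul M).div_const (ε ^ 2)).congr fun s _ => ?_
      simp only [Pi.smul_apply, smul_eq_mul]
      ring)
  have h2 : ∀ s, s ^ (N - 1) * (M * excess p q (Z s)) / ε ^ 2 =
      M / ε ^ 2 * (s ^ (N - 1) * excess p q (Z s)) := fun s => by ring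
  simp only [h2] at h1
  rw [intervalIntegral.integral_const_mul, h.slope_R] at h1
  have h3 : 0 ≤ ∫ s in a..R, s ^ (N - 1) * excess p q (Z s) :=
    intervalIntegral.integral_nonneg ha.2 fun s hs =>
      mul_nonneg (pow_nonneg (ha.1.trans hs.1) _) (excess_nonneg d.p_pos d.q_pos
        (h.nonneg s (hsub hs)))
  have h4 : 0 ≤ a ^ (N - 1) * g a * D a :=
    mul_nonneg (mul_nonneg (pow_nonneg ha.1 _) (d.g_pos a ha).le) (h.slope_nonneg a ha)
  have h5 : M / ε ^ 2 * (∫ s in a..R, s ^ (N - 1) * excess p q (Z s)) ≤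
      R ^ (N - 1) * g R * (K / ε ^ 2) := by linarith
  have h6 := mul_le_mul_of_nonneg_right h5 (by positivity : 0 ≤ ε ^ 2)
  field_simp at h6
  have := mul_le_mul_of_nonneg_right h.le_M h3
  linarith

end IsLayer

/-- The reaction grows superlinearly, so its uniformly bounded integral makes the profiles uniformly
integrable: no mass of `Z` can concentrate in a thin boundary strip. -/
theorem le_mul_excess_add {p q z η : ℝ} (hp : 0 < p) (hq : 0 < q) (hη : 0 < η) (hz : 0 ≤ z) :
    z ≤ η * excess p q z + 1 / (2 * η * q ^ 2) := by
  have h1 := mul_le_mul_of_nonneg_left (sq_le_excess hp hq hz) hη.le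
  have h2 : η * ((q * z) ^ 2 / 2) + 1 / (2 * η * q ^ 2) - z =
      (η * q ^ 2 * z - 1) ^ 2 / (2 * η * q ^ 2) := by field_simp; ring
  have h3 : 0 ≤ (η * q ^ 2 * z - 1) ^ 2 / (2 * η * q ^ 2) := by positivity
  linarith

namespace IsLayerData

variable {N : ℕ} {R p q A K : ℝ} {g : ℝ → ℝ} {M : ℝ → ℝ} {Z D : ℝ → ℝ → ℝ}

/-- The profiles tend to zero in mean. -/
theorem tendsto_integral (d : IsLayerData R p q A K g)
    (hL : ∀ ε, 0 < ε → IsLayer N R p q A g K ε (M ε) (Z ε) (D ε)) :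
    Tendsto (fun ε => ∫ s in (0 : ℝ)..R, s ^ (N - 1) * Z ε s) (𝓝[>] 0) (𝓝 0) := by
  have hR := d.R_pos
  have hA := d.A_pos
  have hq := d.q_pos
  have hgR := d.g_pos R ⟨hR.le, le_rfl⟩
  have hK := d.K_pos
  set C := R ^ (N - 1) * g R * K / A with hC
  have hC0 : 0 < C := by positivity
  -- Split at `R - t`: on the inner part `Z` is at most its value at `R - t`, and on the strip the
  -- previous inequality is integrated.
  have hmain : ∀ η > 0, ∀ t ∈ Ioc 0 (R / 2), ∀ ε > 0,
      (∫ s in (0 : ℝ)..R, s ^ (N - 1) * Z ε s) ≤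
        R * R ^ (N - 1) * Z ε (R - t) + η * C + t * (R ^ (N - 1) / (2 * η * q ^ 2)) := by
    intro η hη t ht ε hε
    have h := hL ε hε
    have ht0 := ht.1
    have ht2 := ht.2
    have hc : ContinuousOn (fun s => s ^ (N - 1) * Z ε s) (Icc 0 R) :=
      (continuousOn_id.pow _).mul h.continuousOn
    have hi : ∀ a b, 0 ≤ a → a ≤ b → b ≤ R →
        IntervalIntegrable (fun s => s ^ (N - 1) * Z ε s) MeasureTheory.volume a b := by
      intro a b ha hab hb
      refine ContinuousOn.intervalIntegrable ?_
      rw [uIcc_of_le hab]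
      exact hc.mono (Icc_subset_Icc ha hb)
    have hmem : R - t ∈ Icc 0 R := ⟨by linarith, by linarith⟩
    rw [← intervalIntegral.integral_add_adjacent_intervals (b := R - t)
      (hi _ _ le_rfl hmem.1 hmem.2) (hi _ _ hmem.1 hmem.2 le_rfl)]
    have hZt := h.nonneg _ hmem
    have h1 : (∫ s in (0 : ℝ)..R - t, s ^ (N - 1) * Z ε s) ≤ R * R ^ (N - 1) * Z ε (R - t) := by
      have := intervalIntegral.integral_mono_on hmem.1 (hi _ _ le_rfl hmem.1 hmem.2)
        (g := fun _ => R ^ (N - 1) * Z ε (R - t)) intervalIntegrable_const (fun s hs => by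
          have hs' : s ∈ Icc 0 R := ⟨hs.1, hs.2.trans hmem.2⟩
          have h2 := h.monotoneOn hs' hmem hs.2
          have h3 := hs'.1
          have h4 := hs'.2
          have h5 := h.nonneg s hs'
          change s ^ (N - 1) * Z ε s ≤ R ^ (N - 1) * Z ε (R - t)
          gcongr)
      rw [intervalIntegral.integral_const, smul_eq_mul, sub_zero] at this
      refine this.trans ?_
      rw [mul_assoc]
      have : R - t ≤ R := hmem.2
      gcongr
    have hce : ContinuousOn (fun s => s ^ (N - 1) * excess p q (Z ε s)) (Icc (R - t) R) :=
      (continuousOn_id.pow _).mul ((continuous_excess p q).comp_continuousOn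
        (h.continuousOn.mono (Icc_subset_Icc_left hmem.1)))
    have hie : IntervalIntegrable (fun s => η * (s ^ (N - 1) * excess p q (Z ε s)))
        MeasureTheory.volume (R - t) R := by
      refine ContinuousOn.intervalIntegrable ?_
      rw [uIcc_of_le hmem.2]
      exact hce.const_smul η
    have h2 : (∫ s in (R - t)..R, s ^ (N - 1) * Z ε s) ≤
        η * C + t * (R ^ (N - 1) / (2 * η * q ^ 2)) := by
      have h3 := intervalIntegral.integral_mono_on hmem.2 (hi _ _ hmem.1 hmem.2 le_rfl)
        (g := fun s => η * (s ^ (N - 1) * excess p q (Z ε s)) + R ^ (N - 1) / (2 * η * q ^ 2))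
        (hie.add intervalIntegrable_const) (fun s hs => by
          have hs' : s ∈ Icc 0 R := ⟨hmem.1.trans hs.1, hs.2⟩
          have h3 := hs'.1
          have h4 := hs'.2
          have h5 := mul_le_mul_of_nonneg_left (le_mul_excess_add d.p_pos hq hη (h.nonneg s hs'))
            (pow_nonneg h3 (N - 1))
          have h6 : s ^ (N - 1) * (1 / (2 * η * q ^ 2)) ≤ R ^ (N - 1) / (2 * η * q ^ 2) := by
            rw [mul_one_div]; gcongr
          change s ^ (N - 1) * Z ε s ≤
            η * (s ^ (N - 1) * excess p q (Z ε s)) + R ^ (N - 1) / (2 * η * q ^ 2)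
          linarith)
      rw [intervalIntegral.integral_add hie intervalIntegrable_const,
        intervalIntegral.integral_const_mul, intervalIntegral.integral_const, smul_eq_mul,
        sub_sub_cancel] at h3
      have h4 := h.integral_excess_le d hmem
      have h5 : (∫ s in (R - t)..R, s ^ (N - 1) * excess p q (Z ε s)) ≤ C := by
        rw [hC, le_div_iff₀ hA]; linarith
      have := mul_le_mul_of_nonneg_left h5 hη.le
      linarith
    linarith
  have hnn : ∀ ε > 0, 0 ≤ ∫ s in (0 : ℝ)..R, s ^ (N - 1) * Z ε s := fun ε hε =>
    intervalIntegral.integral_nonneg hR.le fun s hs =>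
      mul_nonneg (pow_nonneg hs.1 _) ((hL ε hε).nonneg s hs)
  refine tendsto_order.2 ⟨fun a ha => ?_, fun a ha => ?_⟩
  · filter_upwards [eventually_pos_nhdsGT] with ε hε using ha.trans_le (hnn ε hε)
  -- `η` is fixed first, then `t` small depending on `η`, then `ε`; each of the three terms of the
  -- bound costs at most `a / 4`.
  · set η := a / (4 * C) with hη
    have hη0 : 0 < η := by positivity
    set B := R ^ (N - 1) / (2 * η * q ^ 2) with hB
    have hB0 : 0 < B := by positivity
    set t := min (R / 2) (a / (4 * B)) with ht
    have ht0 : 0 < t := by positivity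
    have htm : t ∈ Ioc 0 (R / 2) := ⟨ht0, min_le_left _ _⟩
    have h1 : t * B ≤ a / 4 := by
      calc t * B ≤ a / (4 * B) * B := by gcongr; exact min_le_right _ _
        _ = a / 4 := by field_simp
    have h2 : η * C = a / 4 := by rw [hη]; field_simp
    have h3 : Tendsto (fun ε => R * R ^ (N - 1) * Z ε (R - t)) (𝓝[>] 0) (𝓝 0) := by
      simpa using (d.tendsto_interior hL htm).const_mul (R * R ^ (N - 1))
    filter_upwards [eventually_pos_nhdsGT, h3.eventually (gt_mem_nhds (by linarith : 0 < a / 4))]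
      with ε hε h4
    have := hmain η hη0 t htm ε hε
    linarith

end IsLayerData
-- First integral of the equation and the inner layer.
-- Bookkeeping of the errors in `exists_slope_bounds`. Above, the inner `ζ` is the energy at `R -
-- t`, the square comes from the weight and from `M`, and the outer factor from replacing `s^(N-1)
-- g` by its value at `R`. Below, two factors come from the weight and the primitive, the third from
-- that same replacement.
theorem exists_small_factor {η : ℝ} (hη : 0 < η) :
    ∃ ζ ∈ Ioo (0 : ℝ) 1, (1 + ζ) * (ζ + (1 + ζ) ^ 2) ≤ 1 + η ∧ 1 - η ≤ (1 - ζ) ^ 3 := by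
  have h1 : ∀ᶠ ζ : ℝ in 𝓝[>] 0, (1 + ζ) * (ζ + (1 + ζ) ^ 2) < 1 + η := by
    have : Tendsto (fun ζ : ℝ => (1 + ζ) * (ζ + (1 + ζ) ^ 2)) (𝓝[>] 0) (𝓝 1) := by
      have hc : Continuous fun ζ : ℝ => (1 + ζ) * (ζ + (1 + ζ) ^ 2) := by fun_prop
      simpa using (hc.tendsto 0).mono_left nhdsWithin_le_nhds
    exact this.eventually (gt_mem_nhds (by linarith))
  have h2 : ∀ᶠ ζ : ℝ in 𝓝[>] 0, 1 - η < (1 - ζ) ^ 3 := by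
    have : Tendsto (fun ζ : ℝ => (1 - ζ) ^ 3) (𝓝[>] 0) (𝓝 1) := by
      have hc : Continuous fun ζ : ℝ => (1 - ζ) ^ 3 := by fun_prop
      simpa using (hc.tendsto 0).mono_left nhdsWithin_le_nhds
    exact this.eventually (lt_mem_nhds (by linarith))
  obtain ⟨ζ, h1, h2, h3⟩ := (h1.and (h2.and (Ioo_mem_nhdsGT (zero_lt_one' ℝ)))).exists
  exact ⟨ζ, h3, h1.le, h2.le⟩

namespace IsLayerData

variable {N : ℕ} {R p q A K : ℝ} {g : ℝ → ℝ} {M : ℝ → ℝ} {Z D : ℝ → ℝ → ℝ}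

/-- The first two bounds freeze the energy weight; the last two convert the squared flux into the
squared slope. -/
theorem exists_near_boundary (d : IsLayerData R p q A K g) (N : ℕ) {ζ : ℝ} (hζ : ζ ∈ Ioo 0 1) :
    ∃ t ∈ Ioc 0 (R / 2), ∀ s ∈ Icc (R - t) R,
      (1 - ζ) * ((R ^ (N - 1)) ^ 2 * g R) ≤ (s ^ (N - 1)) ^ 2 * g s ∧
      (s ^ (N - 1)) ^ 2 * g s ≤ (1 + ζ) * ((R ^ (N - 1)) ^ 2 * g R) ∧
      (R ^ (N - 1) * g R) ^ 2 ≤ (1 + ζ) * (s ^ (N - 1) * g s) ^ 2 ∧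
      (1 - ζ) * (s ^ (N - 1) * g s) ^ 2 ≤ (R ^ (N - 1) * g R) ^ 2 := by
  have hR := d.R_pos
  have hgR := d.g_pos R ⟨hR.le, le_rfl⟩
  have hc := d.continuousOn R ⟨hR.le, le_rfl⟩
  rw [ContinuousWithinAt, nhdsWithin_Icc_eq_nhdsLE hR] at hc
  have hid : Tendsto (fun s : ℝ => s ^ (N - 1)) (𝓝[≤] R) (𝓝 (R ^ (N - 1))) :=
    ((continuous_pow (N - 1)).tendsto R).mono_left nhdsWithin_le_nhds
  have h1 := (hid.pow 2).mul hc
  have h2 := (hid.mul hc).pow 2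
  have hp1 : 0 < (R ^ (N - 1)) ^ 2 * g R := by positivity
  have hp2 : 0 < (R ^ (N - 1) * g R) ^ 2 := by positivity
  have e1 := h1.eventually (lt_mem_nhds (by nlinarith [hζ.1] :
    (1 - ζ) * ((R ^ (N - 1)) ^ 2 * g R) < (R ^ (N - 1)) ^ 2 * g R))
  have e2 := h1.eventually (gt_mem_nhds (by nlinarith [hζ.1] :
    (R ^ (N - 1)) ^ 2 * g R < (1 + ζ) * ((R ^ (N - 1)) ^ 2 * g R)))
  have e3 := (h2.const_mul (1 + ζ)).eventually (lt_mem_nhds (by nlinarith [hζ.1] :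
    (R ^ (N - 1) * g R) ^ 2 < (1 + ζ) * (R ^ (N - 1) * g R) ^ 2))
  have e4 := (h2.const_mul (1 - ζ)).eventually (gt_mem_nhds (by nlinarith [hζ.1] :
    (1 - ζ) * (R ^ (N - 1) * g R) ^ 2 < (R ^ (N - 1) * g R) ^ 2))
  obtain ⟨l, hl, hlR⟩ := (mem_nhdsLE_iff_exists_mem_Ico_Ioc_subset hR).1
    (e1.and (e2.and (e3.and e4)))
  refine ⟨min (R / 2) ((R - l) / 2), ⟨lt_min (by linarith) (by linarith [hl.2]), min_le_left _ _⟩,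
    fun s hs => ?_⟩
  have h3 : min (R / 2) ((R - l) / 2) ≤ (R - l) / 2 := min_le_right _ _
  obtain ⟨a, b, c, e⟩ := hlR (⟨by linarith [hl.2, hs.1], hs.2⟩ : s ∈ Ioc l R)
  exact ⟨a.le, b.le, c.le, e.le⟩

set_option maxHeartbeats 1000000 in
/-- The first integral of the layer equation: `ε Z' e^(-qZ/2)` is close to `√(2A/(q g(R)))`
near the boundary, from below only where `Z` is large. -/
theorem exists_slope_bounds (d : IsLayerData R p q A K g)
    (hL : ∀ ε, 0 < ε → IsLayer N R p q A g K ε (M ε) (Z ε) (D ε))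
    (hM : Tendsto M (𝓝[>] 0) (𝓝 A)) {η : ℝ} (hη : η ∈ Ioo 0 1) :
    ∃ t ∈ Ioc 0 (R / 2), ∃ x₀ > 0, ∀ᶠ ε in 𝓝[>] 0, ∀ r ∈ Icc (R - t) R,
      ε * D ε r * Real.exp (-(q / 2 * Z ε r)) ≤ (1 + η) * Real.sqrt (2 * A / (q * g R)) ∧
      (Real.exp (-(q / 2 * Z ε r)) ≤ x₀ →
        (1 - η) * Real.sqrt (2 * A / (q * g R)) ≤ ε * D ε r * Real.exp (-(q / 2 * Z ε r))) := by
  obtain ⟨ζ, hζ, hup, hlow⟩ := exists_small_factor hη.1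
  obtain ⟨t, ht, hnear⟩ := d.exists_near_boundary N hζ
  have hζ0 := hζ.1
  have hζ1 : 0 < 1 - ζ := sub_pos.2 hζ.2
  have hR := d.R_pos
  have hA := d.A_pos
  have hp := d.p_pos
  have hq := d.q_pos
  have hgR := d.g_pos R ⟨hR.le, le_rfl⟩
  set H := (R ^ (N - 1)) ^ 2 * g R with hH
  have hH0 : 0 < H := by positivity
  -- `1 / q + 1 / p` is the loss in `le_excessPrimitive`, and `1` bounds the primitive at `R - t`.
  -- The threshold `x₀ = √(ζ / (q k))` is what makes `k` at most the fraction `ζ` of `e^(qZ) / q`.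
  set k := 1 / q + 1 / p + 1 with hk
  have hk0 : 0 < k := by positivity
  set c := Real.sqrt (2 * A / (q * g R)) with hc
  have hc2 : c ^ 2 * (R ^ (N - 1) * g R) ^ 2 = 2 * H * A / q := by
    rw [hc, Real.sq_sqrt (by positivity)]; field_simp; simp only [hH]; ring
  have hc0 : 0 ≤ c := Real.sqrt_nonneg _
  refine ⟨t, ht, Real.sqrt (ζ / (q * k)), Real.sqrt_pos.2 (by positivity), ?_⟩
  have ev1 : ∀ᶠ ε in 𝓝[>] 0, M ε < (1 + ζ) * A := hM.eventually (gt_mem_nhds (by nlinarith))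
  have ev2 : ∀ᶠ ε in 𝓝[>] 0,
      ε ^ 2 * ((R - t) ^ (N - 1) * g (R - t) * D ε (R - t)) ^ 2 / 2 < ζ * H * A / q := by
    have h1 := d.tendsto_slope_interior hL ht
    have h2 : Tendsto (fun ε : ℝ => ε) (𝓝[>] 0) (𝓝 0) := nhdsWithin_le_nhds
    have h3 := ((h2.pow 2).mul ((h1.const_mul ((R - t) ^ (N - 1) * g (R - t))).pow 2)).div_const 2
    refine h3.eventually (gt_mem_nhds ?_)
    simp only [mul_zero, ne_eq, OfNat.ofNat_ne_zero, not_false_eq_true, zero_pow, zero_div]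
    positivity
  have ev3 : ∀ᶠ ε in 𝓝[>] 0, excessPrimitive p q (Z ε (R - t)) < 1 := by
    have h1 := ((hasDerivAt_excessPrimitive hp hq 0).continuousAt.tendsto.comp
      (d.tendsto_interior hL ht))
    refine h1.eventually (gt_mem_nhds ?_)
    simp [excessPrimitive]
  filter_upwards [eventually_pos_nhdsGT, ev1, ev2, ev3] with ε hε hMε hDε hGε r hr
  have h := hL ε hε
  have ht0 := ht.1
  have ht2 := ht.2
  have hr' : r ∈ Icc 0 R := ⟨by linarith [hr.1], hr.2⟩
  have hMA := h.le_M
  have hM0 : 0 < M ε := hA.trans_le hMA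
  obtain ⟨-, -, hw1, hw2⟩ := hnear r hr
  have hZr := h.nonneg r hr'
  have hDr := h.slope_nonneg r hr'
  set E := Real.exp (q * Z ε r) with hE
  have hE1 : 1 ≤ E := Real.one_le_exp (by positivity)
  set X := Real.exp (-(q / 2 * Z ε r)) with hX
  have hX0 : 0 < X := Real.exp_pos _
  have hXE : X ^ 2 * E = 1 := by
    rw [hX, hE, ← Real.exp_nat_mul, ← Real.exp_add, Real.exp_eq_one_iff]; push_cast; ring
  have hWD : (r ^ (N - 1) * g r * D ε r) ^ 2 = (r ^ (N - 1) * g r) ^ 2 * D ε r ^ 2 := by ring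
  have hpos2 : 0 < (R ^ (N - 1) * g R) ^ 2 := by positivity
  constructor
  · have h1 := h.energy_sub_le hε hp hq hM0 d.continuousOn h.nonneg h.slope_nonneg
      (by linarith) hr.1 hr.2 (m := (1 + ζ) * H) (fun s hs => (hnear s ⟨hs.1, hs.2.trans hr.2⟩).2.1)
    have h2 : (1 + ζ) * H * (M ε * (excessPrimitive p q (Z ε r) -
        excessPrimitive p q (Z ε (R - t)))) ≤ (1 + ζ) * H * ((1 + ζ) * A * (E / q)) := by
      have e1 := excessPrimitive_le hp hq hZr
      have e2 := excessPrimitive_nonneg (z := Z ε (R - t)) hp hq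
      have e3 : excessPrimitive p q (Z ε r) - excessPrimitive p q (Z ε (R - t)) ≤ E / q := by
        linarith
      have e4 : 0 ≤ E / q := by positivity
      calc _ ≤ (1 + ζ) * H * (M ε * (E / q)) := by gcongr
        _ ≤ _ := by gcongr
    have h3 : ζ * H * A / q ≤ ζ * H * A / q * E := le_mul_of_one_le_right (by positivity) hE1
    have h4 : ε ^ 2 * (r ^ (N - 1) * g r) ^ 2 * D ε r ^ 2 ≤
        (ζ + (1 + ζ) ^ 2) * (2 * H * A / q) * E := by
      rw [hWD] at h1
      have : (ζ + (1 + ζ) ^ 2) * (2 * H * A / q) * E =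
        2 * (ζ * H * A / q * E + (1 + ζ) * H * ((1 + ζ) * A * (E / q))) := by ring
      linarith
    have h5 : (ε * D ε r) ^ 2 ≤ (1 + η) * c ^ 2 * E := by
      refine le_of_mul_le_mul_right ?_ hpos2
      calc (ε * D ε r) ^ 2 * (R ^ (N - 1) * g R) ^ 2
          ≤ (ε * D ε r) ^ 2 * ((1 + ζ) * (r ^ (N - 1) * g r) ^ 2) := by gcongr
        _ = (1 + ζ) * (ε ^ 2 * (r ^ (N - 1) * g r) ^ 2 * D ε r ^ 2) := by ring
        _ ≤ (1 + ζ) * ((ζ + (1 + ζ) ^ 2) * (2 * H * A / q) * E) := by gcongr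
        _ = (1 + ζ) * (ζ + (1 + ζ) ^ 2) * ((2 * H * A / q) * E) := by ring
        _ ≤ (1 + η) * ((2 * H * A / q) * E) := by gcongr
        _ = (1 + η) * c ^ 2 * E * (R ^ (N - 1) * g R) ^ 2 := by rw [← hc2]; ring
    have hη0 := hη.1
    rw [← pow_le_pow_iff_left₀ (by positivity) (by positivity) two_ne_zero]
    calc (ε * D ε r * X) ^ 2 = (ε * D ε r) ^ 2 * X ^ 2 := by ring
      _ ≤ (1 + η) * c ^ 2 * E * X ^ 2 := by gcongr
      _ = (1 + η) * c ^ 2 * (X ^ 2 * E) := by ring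
      _ = (1 + η) * c ^ 2 := by rw [hXE, mul_one]
      _ ≤ ((1 + η) * c) ^ 2 := by
        rw [mul_pow]; gcongr; nlinarith
  · intro hx
    have hx2 : X ^ 2 ≤ ζ / (q * k) := by
      rw [← Real.sq_sqrt (by positivity : 0 ≤ ζ / (q * k))]; gcongr
    have hkE : k ≤ ζ * E / q := by
      rw [le_div_iff₀ (by positivity)] at hx2 ⊢
      have := mul_le_mul_of_nonneg_right hx2 (by positivity : 0 ≤ E)
      calc k * q = X ^ 2 * E * (q * k) := by rw [hXE]; ring
        _ = X ^ 2 * (q * k) * E := by ring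
        _ ≤ ζ * E := this
    have h1 := h.le_energy_sub hε hp hq hM0 d.continuousOn h.nonneg h.slope_nonneg
      (by linarith) hr.1 hr.2 (m := (1 - ζ) * H) (fun s hs => (hnear s ⟨hs.1, hs.2.trans hr.2⟩).1)
    have h2 : (1 - ζ) * H * (A * ((1 - ζ) * E / q)) ≤ (1 - ζ) * H * (M ε *
        (excessPrimitive p q (Z ε r) - excessPrimitive p q (Z ε (R - t)))) := by
      have e1 := le_excessPrimitive (q := q) (z := Z ε r) hp
      have e3 : (1 - ζ) * E / q ≤
          excessPrimitive p q (Z ε r) - excessPrimitive p q (Z ε (R - t)) := by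
        have : (1 - ζ) * E / q = E / q - ζ * E / q := by ring
        linarith
      gcongr
    have h0 : 0 ≤ ε ^ 2 * ((R - t) ^ (N - 1) * g (R - t) * D ε (R - t)) ^ 2 / 2 := by positivity
    have h4 : (1 - ζ) ^ 2 * (2 * H * A / q) * E ≤
        ε ^ 2 * (r ^ (N - 1) * g r) ^ 2 * D ε r ^ 2 := by
      rw [hWD] at h1
      have : (1 - ζ) ^ 2 * (2 * H * A / q) * E =
        2 * ((1 - ζ) * H * (A * ((1 - ζ) * E / q))) := by ring
      linarith
    have h5 : (1 - η) * c ^ 2 * E ≤ (ε * D ε r) ^ 2 := by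
      refine le_of_mul_le_mul_right ?_ hpos2
      calc (1 - η) * c ^ 2 * E * (R ^ (N - 1) * g R) ^ 2
          = (1 - η) * ((2 * H * A / q) * E) := by rw [← hc2]; ring
        _ ≤ (1 - ζ) ^ 3 * ((2 * H * A / q) * E) := by gcongr
        _ = (1 - ζ) * ((1 - ζ) ^ 2 * (2 * H * A / q) * E) := by ring
        _ ≤ (1 - ζ) * (ε ^ 2 * (r ^ (N - 1) * g r) ^ 2 * D ε r ^ 2) := by gcongr
        _ = (ε * D ε r) ^ 2 * ((1 - ζ) * (r ^ (N - 1) * g r) ^ 2) := by ring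
        _ ≤ (ε * D ε r) ^ 2 * (R ^ (N - 1) * g R) ^ 2 := by gcongr
    have hη1 : 0 < 1 - η := sub_pos.2 hη.2
    rw [← pow_le_pow_iff_left₀ (by positivity) (by positivity) two_ne_zero]
    calc ((1 - η) * c) ^ 2 ≤ (1 - η) * c ^ 2 := by
          rw [mul_pow]; gcongr; nlinarith [hη.1]
      _ = (1 - η) * c ^ 2 * (X ^ 2 * E) := by rw [hXE, mul_one]
      _ = (1 - η) * c ^ 2 * E * X ^ 2 := by ring
      _ ≤ (ε * D ε r) ^ 2 * X ^ 2 := by gcongr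
      _ = (ε * D ε r * X) ^ 2 := by ring

/-- Two-sided bounds in the part of the layer at distance `o(ε)` from the boundary. -/
theorem eventually_layer_bounds (d : IsLayerData R p q A K g)
    (hL : ∀ ε, 0 < ε → IsLayer N R p q A g K ε (M ε) (Z ε) (D ε))
    (hM : Tendsto M (𝓝[>] 0) (𝓝 A)) {t : ℝ → ℝ} (ht : ∀ᶠ ε in 𝓝[>] 0, 0 ≤ t ε)
    (ht0 : Tendsto (fun ε => t ε / ε) (𝓝[>] 0) (𝓝 0)) {c : ℝ}
    (hc : c = Real.sqrt (2 * A / (q * g R))) {η : ℝ} (hη : η ∈ Ioo 0 1) :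
    ∀ᶠ ε in 𝓝[>] 0,
      (1 - η) * (c / K * ε + q / 2 * c * (t ε / ε)) ≤ Real.exp (-(q / 2 * Z ε (R - t ε))) ∧
      Real.exp (-(q / 2 * Z ε (R - t ε))) ≤ (1 + η) * (c / K * ε + q / 2 * c * (t ε / ε)) ∧
      (1 - η) * c ≤ ε * D ε (R - t ε) * Real.exp (-(q / 2 * Z ε (R - t ε))) ∧
      ε * D ε (R - t ε) * Real.exp (-(q / 2 * Z ε (R - t ε))) ≤ (1 + η) * c := by
  obtain ⟨t₀, ht₀, x₀, hx₀, hev⟩ := d.exists_slope_bounds hL hM hη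
  rw [← hc] at hev
  have hq := d.q_pos
  have hK := d.K_pos
  have hη0 := hη.1
  have hη1 : 0 < 1 - η := sub_pos.2 hη.2
  have hid : Tendsto (fun ε : ℝ => ε) (𝓝[>] 0) (𝓝 0) := nhdsWithin_le_nhds
  have hS : Tendsto (fun ε => (1 + η) * (c / K * ε + q / 2 * c * (t ε / ε))) (𝓝[>] 0) (𝓝 0) := by
    simpa using ((hid.const_mul (c / K)).add (ht0.const_mul (q / 2 * c))).const_mul (1 + η)
  have htt : Tendsto t (𝓝[>] 0) (𝓝 0) := by
    have h1 := ht0.mul hid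
    rw [zero_mul] at h1
    refine h1.congr' ?_
    filter_upwards [eventually_pos_nhdsGT] with ε hε
    field_simp
  filter_upwards [eventually_pos_nhdsGT, hev, ht, hS.eventually (gt_mem_nhds hx₀),
    htt.eventually (gt_mem_nhds ht₀.1)] with ε hε hb htε hSε htε'
  have h := hL ε hε
  have hR := d.R_pos
  have ht₀2 := ht₀.2
  have hmem : ∀ r ∈ Icc (R - t ε) R, r ∈ Icc (R - t₀) R := fun r hr => ⟨by linarith [hr.1], hr.2⟩
  have hsub : Icc (R - t ε) R ⊆ Icc 0 R := Icc_subset_Icc_left (by linarith)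
  have hl : R - t ε ∈ Icc (R - t ε) R := ⟨le_rfl, by linarith⟩
  have hr : R ∈ Icc (R - t ε) R := ⟨by linarith, le_rfl⟩
  set X : ℝ → ℝ := fun r => Real.exp (-(q / 2 * Z ε r)) with hX
  have hXpos : ∀ r, 0 < X r := fun r => Real.exp_pos _
  have hXc : ContinuousOn X (Icc (R - t ε) R) :=
    Real.continuous_exp.comp_continuousOn (((h.continuousOn.mono hsub).const_smul (q / 2)).neg)
  have hXd : ∀ r ∈ Ioo (R - t ε) R, HasDerivAt X (-(q / 2) * (D ε r * X r)) r := by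
    intro r hr
    refine (((h.hasDerivAt r ⟨by linarith [hr.1], hr.2⟩).const_mul (q / 2)).neg.exp).congr_deriv ?_
    simp only [hX, Pi.neg_apply]; ring
  have hbR := hb R (hmem R hr)
  rw [h.slope_R] at hbR
  -- At `R` the slope is `K / ε²`, so the bound on `ε D X` becomes a bound on `X R` itself.
  have hXR : X R ≤ (1 + η) * (c / K * ε) := by
    have h1 : ε * (K / ε ^ 2) * X R ≤ (1 + η) * c := hbR.1
    have h2 := mul_le_mul_of_nonneg_right h1 (by positivity : 0 ≤ ε / K)
    calc X R = ε * (K / ε ^ 2) * X R * (ε / K) := by field_simp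
      _ ≤ _ := h2
      _ = _ := by ring
  have hup : X (R - t ε) ≤ (1 + η) * (c / K * ε + q / 2 * c * (t ε / ε)) := by
    have h1 := mul_sub_le_sub_of_le_hasDerivAt (m := -(q / 2) * ((1 + η) * c / ε)) hl.2 hXc hXd
      (fun r hr => by
        have h2 : ε * D ε r * X r ≤ (1 + η) * c := (hb r (hmem r ⟨hr.1.le, hr.2.le⟩)).1
        have h3 : D ε r * X r ≤ (1 + η) * c / ε := by
          rw [le_div_iff₀ hε]; linarith
        have := mul_le_mul_of_nonneg_left h3 (by positivity : 0 ≤ q / 2)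
        linarith)
    rw [sub_sub_cancel] at h1
    have : (1 + η) * (c / K * ε + q / 2 * c * (t ε / ε)) =
      (1 + η) * (c / K * ε) - -(q / 2) * ((1 + η) * c / ε) * t ε := by ring
    linarith
  -- The upper bound needs no size condition. It makes `X` small at `R - t ε`, hence on the whole
  -- interval since `X` is nonincreasing, and this unlocks the lower slope bound.
  have hsmall : ∀ r ∈ Icc (R - t ε) R, X r ≤ x₀ := by
    intro r hr
    refine le_trans ?_ (hup.trans hSε.le)
    have := h.monotoneOn (hsub hl) (hsub hr) hr.1
    simp only [hX]
    gcongr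
  have hXR' : (1 - η) * (c / K * ε) ≤ X R := by
    have h1 : (1 - η) * c ≤ ε * (K / ε ^ 2) * X R := hbR.2 (hsmall R hr)
    have h2 := mul_le_mul_of_nonneg_right h1 (by positivity : 0 ≤ ε / K)
    calc (1 - η) * (c / K * ε) = (1 - η) * c * (ε / K) := by ring
      _ ≤ _ := h2
      _ = _ := by field_simp
  have hlow : (1 - η) * (c / K * ε + q / 2 * c * (t ε / ε)) ≤ X (R - t ε) := by
    have h1 := mul_sub_le_sub_of_le_hasDerivAt (f := fun r => -X r)
      (m := q / 2 * ((1 - η) * c / ε)) hl.2 hXc.neg (fun r hr => (hXd r hr).neg)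
      (fun r hr => by
        have hr' : r ∈ Icc (R - t ε) R := ⟨hr.1.le, hr.2.le⟩
        have h2 : (1 - η) * c ≤ ε * D ε r * X r := (hb r (hmem r hr')).2 (hsmall r hr')
        have h3 : (1 - η) * c / ε ≤ D ε r * X r := by
          rw [div_le_iff₀ hε]; linarith
        have := mul_le_mul_of_nonneg_left h3 (by positivity : 0 ≤ q / 2)
        linarith)
    rw [sub_sub_cancel] at h1
    have : (1 - η) * (c / K * ε + q / 2 * c * (t ε / ε)) =
      (1 - η) * (c / K * ε) + q / 2 * ((1 - η) * c / ε) * t ε := by ring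
    linarith
  exact ⟨hlow, hup, (hb _ (hmem _ hl)).2 (hsmall _ hl), (hb _ (hmem _ hl)).1⟩

theorem tendsto_of_forall_eventually_mul {l : Filter ℝ} {f : ℝ → ℝ} {c : ℝ} (hc : 0 < c)
    (h : ∀ η ∈ Ioo (0 : ℝ) 1, ∀ᶠ x in l, (1 - η) * c ≤ f x ∧ f x ≤ (1 + η) * c) :
    Tendsto f l (𝓝 c) := by
  rw [Metric.tendsto_nhds]
  intro e he
  set η := min (1 / 2) (e / (2 * c)) with hη
  have h0 : 0 < η := by positivity
  have h1 : η * c ≤ e / 2 := by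
    calc η * c ≤ e / (2 * c) * c := by gcongr; exact min_le_right _ _
      _ = e / 2 := by field_simp
  filter_upwards [h η ⟨h0, (min_le_left _ _).trans_lt (by norm_num)⟩] with x hx
  rw [Real.dist_eq, abs_lt]
  constructor <;> linarith [hx.1, hx.2]

theorem tendsto_layer (d : IsLayerData R p q A K g)
    (hL : ∀ ε, 0 < ε → IsLayer N R p q A g K ε (M ε) (Z ε) (D ε))
    (hM : Tendsto M (𝓝[>] 0) (𝓝 A)) {t : ℝ → ℝ} (ht : ∀ᶠ ε in 𝓝[>] 0, 0 ≤ t ε)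
    (ht0 : Tendsto (fun ε => t ε / ε) (𝓝[>] 0) (𝓝 0)) {c : ℝ}
    (hc : c = Real.sqrt (2 * A / (q * g R))) :
    Tendsto (fun ε => Real.exp (-(q / 2 * Z ε (R - t ε))) /
      (c / K * ε + q / 2 * c * (t ε / ε))) (𝓝[>] 0) (𝓝 1) ∧
    Tendsto (fun ε => ε * D ε (R - t ε) * Real.exp (-(q / 2 * Z ε (R - t ε)))) (𝓝[>] 0) (𝓝 c) := by
  have hq := d.q_pos
  have hK := d.K_pos
  have hA := d.A_pos
  have hgR := d.g_pos R ⟨d.R_pos.le, le_rfl⟩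
  have hc0 : 0 < c := hc ▸ Real.sqrt_pos.2 (by positivity)
  constructor
  · refine tendsto_of_forall_eventually_mul one_pos fun η hη => ?_
    filter_upwards [d.eventually_layer_bounds hL hM ht ht0 hc hη, eventually_pos_nhdsGT, ht]
      with ε h hε htε
    rw [mul_one, mul_one, le_div_iff₀ (by positivity), div_le_iff₀ (by positivity)]
    exact ⟨h.1, h.2.1⟩
  · refine tendsto_of_forall_eventually_mul hc0 fun η hη => ?_
    filter_upwards [d.eventually_layer_bounds hL hM ht ht0 hc hη] with ε h
    exact h.2.2

end IsLayerData
-- From the non-local problem to layers.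
theorem integral_pow_pred {N : ℕ} (hN : 2 ≤ N) (R : ℝ) :
    ∫ s in (0 : ℝ)..R, s ^ (N - 1) = R ^ N / N := by
  rw [integral_pow, Nat.sub_add_cancel (by omega), zero_pow (by omega), sub_zero,
    Nat.cast_sub (by omega)]
  simp

namespace IsNeumannSolution

variable {N : ℕ} {R A B p q ε : ℝ} {g U : ℝ → ℝ}

theorem hasDerivAt (h : IsNeumannSolution N R A B p q g ε U) {r : ℝ} (hr : r ∈ Ioo 0 R) :
    HasDerivAt U (deriv U r) r :=
  ((h.contDiffOn_Ioo.differentiableOn (by simp)).differentiableAt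
    (Ioo_mem_nhds hr.1 hr.2)).hasDerivAt

theorem hasDerivAt_deriv (h : IsNeumannSolution N R A B p q g ε U) {r : ℝ} (hr : r ∈ Ioo 0 R) :
    HasDerivAt (deriv U) (deriv (deriv U) r) r := by
  have h1 : ContDiffOn ℝ 1 (deriv U) (Ioo 0 R) :=
    h.contDiffOn_Ioo.deriv_of_isOpen isOpen_Ioo (by norm_cast)
  exact ((h1.differentiableOn (by simp)).differentiableAt (Ioo_mem_nhds hr.1 hr.2)).hasDerivAt

theorem derivWithin_eq {r : ℝ} (hr : r ∈ Ioo 0 R) : derivWithin U (Icc 0 R) r = deriv U r :=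
  derivWithin_of_mem_nhds (Icc_mem_nhds hr.1 hr.2)

theorem exists_layer (h : IsNeumannSolution N R A B p q g ε U) (hN : 2 ≤ N)
    (d : IsLayerData R p q A (R * (B - A) / (N * g R)) g) (hB : 0 < B) (hε : 0 < ε)
    (hg : ∀ r ∈ Ioo 0 R, DifferentiableAt ℝ g r) :
    ∃ U₀ M : ℝ, IsLayer N R p q A g (R * (B - A) / (N * g R)) ε M (fun r => U₀ - U r)
        (fun r => -derivWithin U (Icc 0 R) r) ∧
      (∀ r, rho N R A B p q U r = M * excess p q (U₀ - U r)) ∧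
      ∫ s in (0 : ℝ)..R, s ^ (N - 1) * (U₀ - U s) = U₀ * (R ^ N / N) ∧
      M * ∫ s in (0 : ℝ)..R, s ^ (N - 1) * Real.exp (-(p * (U₀ - U s))) = A * (R ^ N / N) := by
  have hR := d.R_pos
  have hA := d.A_pos
  have hp := d.p_pos
  have hq := d.q_pos
  have hN0 : (0 : ℝ) < N := by exact_mod_cast (by omega : 0 < N)
  have hUc : ContinuousOn U (Icc 0 R) := h.contDiffOn_Icc.continuousOn
  have hint : ∀ f : ℝ → ℝ, Continuous f →
      IntervalIntegrable (fun s => s ^ (N - 1) * f (U s)) MeasureTheory.volume 0 R := by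
    intro f hf
    refine ContinuousOn.intervalIntegrable ?_
    rw [uIcc_of_le hR.le]
    exact (continuousOn_id.pow _).mul (hf.comp_continuousOn hUc)
  have hposint : ∀ f : ℝ → ℝ, Continuous f → (∀ x, 0 < f x) →
      0 < ∫ s in (0 : ℝ)..R, s ^ (N - 1) * f (U s) := fun f hf hf0 =>
    intervalIntegral.intervalIntegral_pos_of_pos_on (hint f hf)
      (fun x hx => mul_pos (pow_pos hx.1 _) (hf0 _)) hR
  have hIp := hposint (fun u => Real.exp (p * u)) (by fun_prop) (fun _ => Real.exp_pos _)
  have hIq := hposint (fun u => Real.exp (-(q * u))) (by fun_prop) (fun _ => Real.exp_pos _)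
  set Ip := ∫ s in (0 : ℝ)..R, s ^ (N - 1) * Real.exp (p * U s) with hIp_def
  set Iq := ∫ s in (0 : ℝ)..R, s ^ (N - 1) * Real.exp (-(q * U s)) with hIq_def
  set a := R ^ N / N * A / Ip with ha
  set b := R ^ N / N * B / Iq with hb
  have ha0 : 0 < a := by positivity
  have hb0 : 0 < b := by positivity
  -- The unique root of `a e^(pu) = b e^(-qu)`; with `M` the common value, the reaction factors as
  -- `M * excess p q (U₀ - u)`.
  set U₀ := Real.log (b / a) / (p + q) with hU₀
  have hbal : b * Real.exp (-(q * U₀)) = a * Real.exp (p * U₀) := by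
    have h1 : Real.exp ((p + q) * U₀) = b / a := by
      rw [hU₀, mul_div_cancel₀ _ (by positivity), Real.exp_log (by positivity)]
    have h2 : b = a * Real.exp ((p + q) * U₀) := by rw [h1]; field_simp
    rw [h2, mul_assoc, ← Real.exp_add]; ring_nf
  set M := a * Real.exp (p * U₀) with hM
  have hM0 : 0 < M := by positivity
  have hreac : ∀ u, M * excess p q (U₀ - u) = b * Real.exp (-(q * u)) - a * Real.exp (p * u) := by
    intro u
    have e1 : M * Real.exp (q * (U₀ - u)) = b * Real.exp (-(q * u)) := by
      rw [← hbal, mul_assoc, ← Real.exp_add]; ring_nf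
    have e2 : M * Real.exp (-(p * (U₀ - u))) = a * Real.exp (p * u) := by
      rw [hM, mul_assoc, ← Real.exp_add]; ring_nf
    rw [excess, mul_sub, e1, e2]
  -- The slope is the derivative within `[0,R]`: it is continuous up to the endpoints, takes the
  -- Neumann values there, and agrees with `deriv` inside.
  have hprof : IsProfile N R p q g (R * (B - A) / (N * g R)) ε M (fun r => U₀ - U r)
      (fun r => -derivWithin U (Icc 0 R) r) := by
    refine ⟨continuousOn_const.sub hUc, ?_, ?_, ?_, ?_, ?_⟩
    · exact (h.contDiffOn_Icc.continuousOn_derivWithin (uniqueDiffOn_Icc hR) le_rfl).neg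
    · intro r hr
      have := (h.hasDerivAt hr).const_sub U₀
      rwa [← derivWithin_eq hr] at this
    · intro r hr
      have h1 : HasDerivAt (fun r => -derivWithin U (Icc 0 R) r) (-deriv (deriv U) r) r := by
        refine (h.hasDerivAt_deriv hr).neg.congr_of_eventuallyEq ?_
        filter_upwards [Ioo_mem_nhds hr.1 hr.2] with s hs
        simp [derivWithin_eq hs]
      have h2 := ((hasDerivAt_pow (N - 1) r).mul (hg r hr).hasDerivAt).mul h1
      refine h2.congr_deriv ?_
      have heq := h.equation r hr
      have hgr := d.g_pos r ⟨hr.1.le, hr.2.le⟩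
      have hr0 := hr.1
      rw [derivWithin_eq hr, hreac]
      have hF : b * Real.exp (-(q * U r)) - a * Real.exp (p * U r) = -(ε ^ 2 * g r *
          (deriv (deriv U) r + (((N : ℝ) - 1) / r + deriv g r / g r) * deriv U r)) := by
        rw [heq, ha, hb]; ring
      rw [hF]
      obtain ⟨k, rfl⟩ : ∃ k, N = k + 2 := ⟨N - 2, by omega⟩
      simp only [Pi.mul_apply, show k + 2 - 1 = k + 1 by omega, Nat.add_sub_cancel]
      push_cast
      field_simp
      ring
    · have := h.neumann_zero.derivWithin (uniqueDiffOn_Icc hR 0 ⟨le_rfl, hR.le⟩)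
      simp [this]
    · have := h.neumann_R.derivWithin (uniqueDiffOn_Icc hR R ⟨hR.le, le_rfl⟩)
      have hgR := d.g_pos R ⟨hR.le, le_rfl⟩
      simp only [this]
      field_simp
      ring
  have hnn := hprof.nonneg hR hp hq d.K_pos hε hM0 d.continuousOn d.g_pos
  have hmass : M * ∫ s in (0 : ℝ)..R, s ^ (N - 1) * Real.exp (-(p * (U₀ - U s))) =
      A * (R ^ N / N) := by
    have e1 : ∀ s, s ^ (N - 1) * Real.exp (-(p * (U₀ - U s))) =
        Real.exp (-(p * U₀)) * (s ^ (N - 1) * Real.exp (p * U s)) := by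
      intro s
      rw [mul_left_comm, ← Real.exp_add]; ring_nf
    simp only [e1]
    rw [intervalIntegral.integral_const_mul, ← hIp_def, hM, ha, Real.exp_neg]
    field_simp
  -- Since `Z ≥ 0`, the integral multiplying `M` in `hmass` is at most `R^N / N`.
  have hAM : A ≤ M := by
    have h1 : (∫ s in (0 : ℝ)..R, s ^ (N - 1) * Real.exp (-(p * (U₀ - U s)))) ≤ R ^ N / N := by
      rw [← integral_pow_pred hN]
      refine intervalIntegral.integral_mono_on hR.le
        (hint (fun u => Real.exp (-(p * (U₀ - u)))) (by fun_prop))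
        (by simp) fun s hs => ?_
      have h2 : Real.exp (-(p * (U₀ - U s))) ≤ 1 :=
        Real.exp_le_one_iff.2 (by have := mul_nonneg hp.le (hnn s hs); linarith)
      exact mul_le_of_le_one_right (pow_nonneg hs.1 _) h2
    have h2 := mul_le_mul_of_nonneg_left h1 hM0.le
    rw [hmass] at h2
    exact le_of_mul_le_mul_right h2 (by positivity)
  refine ⟨U₀, M, ⟨hprof, hε, hAM, hnn, hprof.slope_nonneg hR hp hq hM0 d.continuousOn d.g_pos hnn⟩,
    fun r => ?_, ?_, hmass⟩
  · rw [hreac, rho, ← hIp_def, ← hIq_def, ha, hb]; ring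
  · simp only [mul_sub]
    rw [intervalIntegral.integral_sub
      (by simp) (hint (fun u => u) continuous_id),
      h.mean_zero, intervalIntegral.integral_mul_const, integral_pow_pred hN]
    ring

end IsNeumannSolution

/-- A family of solutions as a family of layers, with interior value tending to `0`. -/
theorem exists_layer_family {N : ℕ} (hN : 2 ≤ N) {R A B p q : ℝ} (hB : 0 < B) {g : ℝ → ℝ}
    (d : IsLayerData R p q A (R * (B - A) / (N * g R)) g)
    (hg : ∀ r ∈ Ioo 0 R, DifferentiableAt ℝ g r) {U : ℝ → ℝ → ℝ}
    (hU : ∀ ε : ℝ, 0 < ε → IsNeumannSolution N R A B p q g ε (U ε)) :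
    ∃ U₀ M : ℝ → ℝ, (∀ ε, 0 < ε → IsLayer N R p q A g (R * (B - A) / (N * g R)) ε (M ε)
        (fun r => U₀ ε - U ε r) (fun r => -derivWithin (U ε) (Icc 0 R) r)) ∧
      (∀ ε, 0 < ε → ∀ r, rho N R A B p q (U ε) r = M ε * excess p q (U₀ ε - U ε r)) ∧
      Tendsto U₀ (𝓝[>] 0) (𝓝 0) ∧ Tendsto M (𝓝[>] 0) (𝓝 A) := by
  choose! U₀ M hL hrho hmean hmass using
    fun ε (hε : 0 < ε) => (hU ε hε).exists_layer hN d hB hε hg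
  have hR := d.R_pos
  have hp := d.p_pos
  have hN0 : (0 : ℝ) < N := by exact_mod_cast (by omega : 0 < N)
  have hI := d.tendsto_integral hL
  have hV : 0 < R ^ N / N := by positivity
  refine ⟨U₀, M, hL, hrho, ?_, ?_⟩
  · have h1 := hI.div_const (R ^ N / N)
    rw [zero_div] at h1
    refine h1.congr' ?_
    filter_upwards [eventually_pos_nhdsGT] with ε hε
    rw [hmean ε hε, mul_div_cancel_right₀ _ hV.ne']
  · set J : ℝ → ℝ := fun ε => ∫ s in (0 : ℝ)..R, s ^ (N - 1) * Real.exp (-(p * (U₀ ε - U ε s)))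
      with hJ
    have hJt : Tendsto J (𝓝[>] 0) (𝓝 (R ^ N / N)) := by
      -- From `e^(-pZ) ≥ 1 - pZ` and convergence of `Z` to zero in mean; the matching upper bound on
      -- `J` is equivalent to `A ≤ M`.
      have hlow : Tendsto (fun ε => R ^ N / N -
          p * ∫ s in (0 : ℝ)..R, s ^ (N - 1) * (U₀ ε - U ε s)) (𝓝[>] 0) (𝓝 (R ^ N / N)) := by
        simpa using (hI.const_mul p).const_sub (R ^ N / N)
      refine tendsto_of_tendsto_of_tendsto_of_le_of_le' hlow tendsto_const_nhds ?_ ?_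
      · filter_upwards [eventually_pos_nhdsGT] with ε hε
        have hc := (hL ε hε).continuousOn
        have hint : ∀ f : ℝ → ℝ, Continuous f →
            IntervalIntegrable (fun s => s ^ (N - 1) * f (U₀ ε - U ε s))
              MeasureTheory.volume 0 R := by
          intro f hf
          refine ContinuousOn.intervalIntegrable ?_
          rw [uIcc_of_le hR.le]
          exact (continuousOn_id.pow _).mul (hf.comp_continuousOn hc)
        have h1 := intervalIntegral.integral_mono_on hR.le
          (hint (fun z => 1 - p * z) (by fun_prop))
          (hint (fun z => Real.exp (-(p * z))) (by fun_prop)) fun s hs =>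
            mul_le_mul_of_nonneg_left (by linarith [Real.add_one_le_exp (-(p * (U₀ ε - U ε s)))])
              (pow_nonneg hs.1 _)
        refine le_trans (le_of_eq ?_) h1
        have e1 : ∀ s, s ^ (N - 1) * (1 - p * (U₀ ε - U ε s)) =
            s ^ (N - 1) - p * (s ^ (N - 1) * (U₀ ε - U ε s)) := fun s => by ring
        simp only [e1]
        rw [intervalIntegral.integral_sub (by simp)
          ((hint (fun z => z) continuous_id).const_mul p), integral_pow_pred hN,
          intervalIntegral.integral_const_mul]
      · filter_upwards [eventually_pos_nhdsGT] with ε hε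
        have h1 := hmass ε hε
        have hA := d.A_pos
        have hM := (hL ε hε).le_M
        have hM0 : 0 < M ε := hA.trans_le hM
        by_contra! hc
        have h2 : M ε * (R ^ N / N) < M ε * J ε := by gcongr
        have h3 : A * (R ^ N / N) ≤ M ε * (R ^ N / N) := by gcongr
        simp only [hJ] at h2
        linarith
    have h1 := (tendsto_const_nhds (x := A * (R ^ N / N))).div hJt hV.ne'
    rw [mul_div_cancel_right₀ _ hV.ne'] at h1
    refine h1.congr' ?_
    filter_upwards [eventually_pos_nhdsGT, hJt.eventually (lt_mem_nhds hV)] with ε hε hJε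
    rw [Pi.div_apply, ← hmass ε hε]
    exact mul_div_cancel_right₀ _ hJε.ne'

/-! ### Asymptotics of the solutions in the two regimes and in the interior. -/

/-- Behaviour of the solutions at distance `t ε = o(ε)` from the boundary, in terms of a function
`T` equivalent to `√(2A/(q g(R))) (ε / K + q t / (2 ε))`. -/
structure IsLayerScale (R A q K : ℝ) (g t T : ℝ → ℝ) : Prop where
  t_pos : ∀ᶠ ε in 𝓝[>] 0, 0 < t ε
  tendsto_t : Tendsto (fun ε => t ε / ε) (𝓝[>] 0) (𝓝 0)
  T_pos : ∀ᶠ ε in 𝓝[>] 0, 0 < T ε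
  tendsto_T : Tendsto T (𝓝[>] 0) (𝓝 0)
  ratio : Tendsto (fun ε => (Real.sqrt (2 * A / (q * g R)) / K * ε +
    q / 2 * Real.sqrt (2 * A / (q * g R)) * (t ε / ε)) / T ε) (𝓝[>] 0) (𝓝 1)

theorem tendsto_of_tendsto_div {t : ℝ → ℝ} (ht : Tendsto (fun ε => t ε / ε) (𝓝[>] 0) (𝓝 0)) :
    Tendsto t (𝓝[>] 0) (𝓝 0) := by
  have h1 := ht.mul (nhdsWithin_le_nhds : Tendsto (fun ε : ℝ => ε) (𝓝[>] 0) (𝓝 0))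
  rw [zero_mul] at h1
  refine h1.congr' ?_
  filter_upwards [eventually_pos_nhdsGT] with ε hε
  field_simp

/-- With `X = e^(-q(U₀-U)/2) ~ T`, the potential is `U₀ + (2/q) log X`, the slope follows from `ε D
X → c`, and the charge density from `M (X⁻² - e^(-pZ))`. -/
theorem layer_asymptotics {N : ℕ} (hN : 2 ≤ N) {R A B p q : ℝ} (hB : 0 < B) {g : ℝ → ℝ}
    (d : IsLayerData R p q A (R * (B - A) / (N * g R)) g)
    (hg : ∀ r ∈ Ioo 0 R, DifferentiableAt ℝ g r) {U : ℝ → ℝ → ℝ}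
    (hU : ∀ ε : ℝ, 0 < ε → IsNeumannSolution N R A B p q g ε (U ε)) {t T : ℝ → ℝ}
    (hs : IsLayerScale R A q (R * (B - A) / (N * g R)) g t T) :
    Tendsto (fun ε => U ε (R - t ε) - 2 / q * Real.log (T ε)) (𝓝[>] 0) (𝓝 0) ∧
    (fun ε => deriv (U ε) (R - t ε)) ~[𝓝[>] 0]
      (fun ε => -(Real.sqrt (2 * A / (q * g R)) / (ε * T ε))) ∧
    (fun ε => rho N R A B p q (U ε) (R - t ε)) ~[𝓝[>] 0] (fun ε => A / T ε ^ 2) := by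
  obtain ⟨U₀, M, hL, hrho, hU₀, hM⟩ := exists_layer_family hN hB d hg hU
  have hA := d.A_pos
  have hq := d.q_pos
  have hp := d.p_pos
  have hR := d.R_pos
  have hgR := d.g_pos R ⟨hR.le, le_rfl⟩
  obtain ⟨h1, h2⟩ := d.tendsto_layer hL hM (hs.t_pos.mono fun _ h => h.le) hs.tendsto_t rfl
  set c := Real.sqrt (2 * A / (q * g R)) with hc
  have hc0 : 0 < c := Real.sqrt_pos.2 (by positivity)
  set X : ℝ → ℝ := fun ε => Real.exp (-(q / 2 * (U₀ ε - U ε (R - t ε)))) with hX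
  have hXpos : ∀ ε, 0 < X ε := fun ε => Real.exp_pos _
  have hmem : ∀ᶠ ε in 𝓝[>] 0, R - t ε ∈ Ioo 0 R := by
    filter_upwards [hs.t_pos, (tendsto_of_tendsto_div hs.tendsto_t).eventually (gt_mem_nhds hR)]
      with ε h3 h4
    exact ⟨by linarith, by linarith⟩
  have hXT : Tendsto (fun ε => X ε / T ε) (𝓝[>] 0) (𝓝 1) := by
    have h3 := h1.mul hs.ratio
    rw [one_mul] at h3
    refine h3.congr' ?_
    filter_upwards [hs.ratio.eventually (lt_mem_nhds zero_lt_one)] with ε h4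
    rw [div_mul_div_cancel₀]
    intro h5
    rw [h5, zero_div] at h4
    exact lt_irrefl _ h4
  refine ⟨?_, ?_, ?_⟩
  · have h3 := hU₀.add (((Real.continuousAt_log one_ne_zero).tendsto.comp hXT).const_mul (2 / q))
    rw [Real.log_one, mul_zero, add_zero] at h3
    refine h3.congr' ?_
    filter_upwards [hs.T_pos] with ε hT
    rw [Function.comp_apply, Real.log_div (hXpos ε).ne' hT.ne', Real.log_exp]
    field_simp
    ring
  · refine (isEquivalent_iff_tendsto_one ?_).2 ?_
    · filter_upwards [hs.T_pos, eventually_pos_nhdsGT] with ε hT hε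
      exact neg_ne_zero.2 (by positivity)
    · have h3 := (h2.div_const c).div hXT one_ne_zero
      rw [div_self hc0.ne', div_one] at h3
      refine h3.congr' ?_
      filter_upwards [hs.T_pos, eventually_pos_nhdsGT, hmem] with ε hT hε hm
      have := hXpos ε
      simp only [Pi.div_apply, IsNeumannSolution.derivWithin_eq hm]
      change ε * -deriv (U ε) (R - t ε) * X ε / c / (X ε / T ε) = _
      field_simp
  · refine (isEquivalent_iff_tendsto_one ?_).2 ?_
    · filter_upwards [hs.T_pos] with ε hT
      positivity
    · have h4 : Tendsto (fun ε => T ε ^ 2 * Real.exp (-(p * (U₀ ε - U ε (R - t ε))))) (𝓝[>] 0)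
          (𝓝 0) := by
        have h5 : Tendsto (fun ε => T ε ^ 2) (𝓝[>] 0) (𝓝 0) := by simpa using hs.tendsto_T.pow 2
        refine squeeze_zero' ?_ ?_ h5
        · exact Eventually.of_forall fun ε => by positivity
        · filter_upwards [hmem, eventually_pos_nhdsGT] with ε hm hε
          have := (hL ε hε).nonneg _ ⟨hm.1.le, hm.2.le⟩
          exact mul_le_of_le_one_right (by positivity) (Real.exp_le_one_iff.2 (by nlinarith))
      have h3 := (hM.div_const A).mul (((hXT.pow 2).inv₀ (by norm_num)).sub h4)
      rw [div_self hA.ne', one_pow, inv_one, sub_zero, one_mul] at h3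
      refine h3.congr' ?_
      filter_upwards [hs.T_pos, eventually_pos_nhdsGT] with ε hT hε
      have hX0 := hXpos ε
      have hE : Real.exp (q * (U₀ ε - U ε (R - t ε))) = (X ε ^ 2)⁻¹ := by
        rw [hX, ← Real.exp_nat_mul, ← Real.exp_neg]; congr 1; push_cast; ring
      rw [Pi.div_apply, hrho ε hε, excess, hE]
      field_simp

/-- The regime `ε² ≪ R - r ≪ ε`. -/
theorem asymptotics_of_sq_isLittleO {N : ℕ} (hN : 2 ≤ N) {R A B p q : ℝ} (hB : 0 < B) {g : ℝ → ℝ}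
    (d : IsLayerData R p q A (R * (B - A) / (N * g R)) g)
    (hg : ∀ r ∈ Ioo 0 R, DifferentiableAt ℝ g r) {U : ℝ → ℝ → ℝ}
    (hU : ∀ ε : ℝ, 0 < ε → IsNeumannSolution N R A B p q g ε (U ε)) {t : ℝ → ℝ}
    (ht : ∀ᶠ ε in 𝓝[>] 0, 0 < t ε) (ht1 : Tendsto (fun ε => t ε / ε) (𝓝[>] 0) (𝓝 0))
    (ht2 : Tendsto (fun ε => t ε / ε ^ 2) (𝓝[>] 0) atTop) :
    Tendsto (fun ε => U ε (R - t ε) - (2 / q * Real.log (t ε / ε) +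
      2 / q * Real.log (Real.sqrt (q * A / (2 * g R))))) (𝓝[>] 0) (𝓝 0) ∧
    (fun ε => deriv (U ε) (R - t ε)) ~[𝓝[>] 0] (fun ε => -(2 / (q * t ε))) ∧
    (fun ε => rho N R A B p q (U ε) (R - t ε)) ~[𝓝[>] 0]
      (fun ε => 2 * g R / q * (ε / t ε) ^ 2) := by
  have hA := d.A_pos
  have hq := d.q_pos
  have hK := d.K_pos
  have hgR := d.g_pos R ⟨d.R_pos.le, le_rfl⟩
  set k := Real.sqrt (q * A / (2 * g R)) with hk
  have hk0 : 0 < k := Real.sqrt_pos.2 (by positivity)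
  have hk2 : k ^ 2 = q * A / (2 * g R) := Real.sq_sqrt (by positivity)
  have hck : Real.sqrt (2 * A / (q * g R)) = 2 / q * k := by
    rw [Real.sqrt_eq_iff_mul_self_eq_of_pos (by positivity), ← pow_two, mul_pow, hk2]
    field_simp
  -- Here `c = 2k/q`, so `k t/ε` is the second summand of the layer formula; the first is smaller by
  -- a factor of order `ε²/t`.
  have hs : IsLayerScale R A q (R * (B - A) / (N * g R)) g t (fun ε => k * (t ε / ε)) := by
    refine ⟨ht, ht1, ?_, by simpa using ht1.const_mul k, ?_⟩
    · filter_upwards [ht, eventually_pos_nhdsGT] with ε h1 h2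
      positivity
    · have h1 := (ht2.inv_tendsto_atTop.const_mul (2 / (q * (R * (B - A) / (N * g R))))).const_add 1
      rw [mul_zero, add_zero] at h1
      refine h1.congr' ?_
      rw [hck]
      generalize R * (B - A) / (N * g R) = K at hK
      filter_upwards [ht, eventually_pos_nhdsGT] with ε h1 h2
      simp only [Pi.inv_apply]
      field_simp
      ring
  obtain ⟨h1, h2, h3⟩ := layer_asymptotics hN hB d hg hU hs
  refine ⟨h1.congr' ?_, h2.congr_right ?_, h3.congr_right ?_⟩
  · filter_upwards [ht, eventually_pos_nhdsGT] with ε h4 h5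
    rw [Real.log_mul hk0.ne' (by positivity)]
    ring
  · filter_upwards [ht, eventually_pos_nhdsGT] with ε h4 h5
    rw [hck]
    field_simp
  · filter_upwards [ht, eventually_pos_nhdsGT] with ε h4 h5
    rw [mul_pow, hk2]
    field_simp

/-- The regime `R - r ≪ ε²`. -/
theorem asymptotics_of_isLittleO_sq {N : ℕ} (hN : 2 ≤ N) {R A B p q : ℝ} (hB : 0 < B) {g : ℝ → ℝ}
    (d : IsLayerData R p q A (R * (B - A) / (N * g R)) g)
    (hg : ∀ r ∈ Ioo 0 R, DifferentiableAt ℝ g r) {U : ℝ → ℝ → ℝ}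
    (hU : ∀ ε : ℝ, 0 < ε → IsNeumannSolution N R A B p q g ε (U ε)) {t : ℝ → ℝ}
    (ht : ∀ᶠ ε in 𝓝[>] 0, 0 < t ε) (ht1 : Tendsto (fun ε => t ε / ε) (𝓝[>] 0) (𝓝 0))
    (ht2 : Tendsto (fun ε => t ε / ε ^ 2) (𝓝[>] 0) (𝓝 0)) :
    Tendsto (fun ε => U ε (R - t ε) - (-(2 / q) * Real.log (1 / ε) +
      2 / q * Real.log (Real.sqrt (A / (2 * q * g R)) * (2 * N * g R / (R * (B - A))))))
      (𝓝[>] 0) (𝓝 0) ∧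
    (fun ε => deriv (U ε) (R - t ε)) ~[𝓝[>] 0]
      (fun ε => -(R * (B - A) / (N * g R)) * (ε ^ 2)⁻¹) ∧
    (fun ε => rho N R A B p q (U ε) (R - t ε)) ~[𝓝[>] 0]
      (fun ε => q * R ^ 2 * (B - A) ^ 2 / (2 * N ^ 2 * g R) * (ε ^ 2)⁻¹) := by
  have hA := d.A_pos
  have hq := d.q_pos
  have hK := d.K_pos
  have hR := d.R_pos
  have hgR := d.g_pos R ⟨d.R_pos.le, le_rfl⟩
  have hN0 : (0 : ℝ) < N := by exact_mod_cast (by omega : 0 < N)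
  have hBA : 0 < B - A := by
    by_contra! hc
    exact hK.not_ge (div_nonpos_of_nonpos_of_nonneg (mul_nonpos_of_nonneg_of_nonpos hR.le hc)
      (by positivity))
  set k := Real.sqrt (A / (2 * q * g R)) with hk
  have hk0 : 0 < k := Real.sqrt_pos.2 (by positivity)
  have hk2 : k ^ 2 = A / (2 * q * g R) := Real.sq_sqrt (by positivity)
  have hck : Real.sqrt (2 * A / (q * g R)) = 2 * k := by
    rw [Real.sqrt_eq_iff_mul_self_eq_of_pos (by positivity), ← pow_two, mul_pow, hk2]
    field_simp
  -- Here `c = 2k`, so this `T` is the first summand `cε/K`; the second is smaller by a factor of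
  -- order `t/ε²`.
  have hs : IsLayerScale R A q (R * (B - A) / (N * g R)) g t
      (fun ε => k * (2 * N * g R / (R * (B - A))) * ε) := by
    have hid : Tendsto (fun ε : ℝ => ε) (𝓝[>] 0) (𝓝 0) := nhdsWithin_le_nhds
    refine ⟨ht, ht1, ?_, by simpa using hid.const_mul (k * (2 * N * g R / (R * (B - A)))), ?_⟩
    · filter_upwards [eventually_pos_nhdsGT] with ε h2
      positivity
    · have h1 := (ht2.const_mul (q / 2 * (R * (B - A) / (N * g R)))).const_add 1
      rw [mul_zero, add_zero] at h1
      refine h1.congr' ?_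
      rw [hck]
      filter_upwards [eventually_pos_nhdsGT] with ε h2
      field_simp
  obtain ⟨h1, h2, h3⟩ := layer_asymptotics hN hB d hg hU hs
  refine ⟨h1.congr' ?_, h2.congr_right ?_, h3.congr_right ?_⟩
  · filter_upwards [eventually_pos_nhdsGT] with ε h5
    rw [Real.log_mul (by positivity) h5.ne', one_div, Real.log_inv]
    ring
  · filter_upwards [eventually_pos_nhdsGT] with ε h5
    rw [hck]
    field_simp
  · filter_upwards [eventually_pos_nhdsGT] with ε h5
    rw [mul_pow, mul_pow, hk2]
    field_simp

/-- Far from the boundary on the scale `ε`, with `t ε` such that the exponential decay beats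
`(t ε)⁻²`, the solution and its derivative tend to zero. -/
theorem tendsto_zero_of_decay {N : ℕ} (hN : 2 ≤ N) {R A B p q : ℝ} (hB : 0 < B) {g : ℝ → ℝ}
    (d : IsLayerData R p q A (R * (B - A) / (N * g R)) g)
    (hg : ∀ r ∈ Ioo 0 R, DifferentiableAt ℝ g r) {U : ℝ → ℝ → ℝ}
    (hU : ∀ ε : ℝ, 0 < ε → IsNeumannSolution N R A B p q g ε (U ε)) {t : ℝ → ℝ}
    (ht : ∀ᶠ ε in 𝓝[>] 0, 0 < t ε) (ht0 : Tendsto t (𝓝[>] 0) (𝓝 0))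
    (hdec : ∀ σ > 0,
      Tendsto (fun ε => 1 / t ε ^ 2 * Real.exp (-(σ * t ε / ε))) (𝓝[>] 0) (𝓝 0)) :
    Tendsto (fun ε => U ε (R - t ε)) (𝓝[>] 0) (𝓝 0) ∧
    Tendsto (fun ε => deriv (U ε) (R - t ε)) (𝓝[>] 0) (𝓝 0) := by
  obtain ⟨U₀, M, hL, -, hU₀, -⟩ := exists_layer_family hN hB d hg hU
  have hR := d.R_pos
  have hmem : ∀ᶠ ε in 𝓝[>] 0, t ε ∈ Ioc 0 (R / 2) ∧ R - t ε ∈ Ioo 0 R := by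
    filter_upwards [ht, ht0.eventually (gt_mem_nhds (half_pos hR))] with ε h3 h4
    exact ⟨⟨h3, h4.le⟩, by linarith, by linarith⟩
  constructor
  · obtain ⟨C, hC, σ, hσ, h⟩ := d.exists_decay N
    have h1 : Tendsto (fun ε => C * (t ε * (1 / t ε ^ 2 * Real.exp (-(σ * t ε / ε))))) (𝓝[>] 0)
        (𝓝 0) := by simpa using (ht0.mul (hdec σ hσ)).const_mul C
    have h2 : Tendsto (fun ε => U₀ ε - U ε (R - t ε)) (𝓝[>] 0) (𝓝 0) := by
      refine squeeze_zero' ?_ ?_ h1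
      · filter_upwards [hmem, eventually_pos_nhdsGT] with ε hm hε
        exact (hL ε hε).nonneg _ ⟨hm.2.1.le, hm.2.2.le⟩
      · filter_upwards [hmem, eventually_pos_nhdsGT] with ε hm hε
        refine (h _ _ _ _ (hL ε hε) _ hm.1).trans_eq ?_
        have := hm.1.1
        field_simp
    simpa using hU₀.sub h2
  · obtain ⟨C, hC, σ, hσ, h⟩ := d.exists_slope_decay N
    have h1 : Tendsto (fun ε => C * (1 / t ε ^ 2 * Real.exp (-(σ * t ε / ε)))) (𝓝[>] 0)
        (𝓝 0) := by simpa using (hdec σ hσ).const_mul C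
    have h2 : Tendsto (fun ε => -deriv (U ε) (R - t ε)) (𝓝[>] 0) (𝓝 0) := by
      refine squeeze_zero' ?_ ?_ h1
      · filter_upwards [hmem, eventually_pos_nhdsGT] with ε hm hε
        rw [← IsNeumannSolution.derivWithin_eq hm.2]
        exact (hL ε hε).slope_nonneg _ ⟨hm.2.1.le, hm.2.2.le⟩
      · filter_upwards [hmem, eventually_pos_nhdsGT] with ε hm hε
        rw [← IsNeumannSolution.derivWithin_eq hm.2]
        refine (h _ _ _ _ (hL ε hε) _ hm.1).trans_eq ?_
        ring
    simpa using h2.neg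

/-! ### Scales: non-power distances and exponents tending to one. -/

theorem tendsto_log_one_div : Tendsto (fun ε : ℝ => Real.log (1 / ε)) (𝓝[>] 0) atTop := by
  simp only [one_div]
  exact Real.tendsto_log_atTop.comp tendsto_inv_nhdsGT_zero

theorem rpow_eq_exp_neg_mul_log {ε : ℝ} (hε : 0 < ε) (b : ℝ) :
    ε ^ b = Real.exp (-(b * Real.log (1 / ε))) := by
  rw [Real.rpow_def_of_pos hε, one_div, Real.log_inv]; ring_nf

theorem log_div_rpow {t ε : ℝ} (ht : 0 < t) (hε : 0 < ε) (b : ℝ) :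
    Real.log (t / ε ^ b) = Real.log t + b * Real.log (1 / ε) := by
  rw [Real.log_div ht.ne' (Real.rpow_pos_of_pos hε b).ne', Real.log_rpow hε, one_div, Real.log_inv]
  ring

namespace IsNonPowerScale

variable {β₀ : ℝ} {t : ℝ → ℝ}

theorem tendsto_div (h : IsNonPowerScale β₀ t) :
    Tendsto (fun ε => t ε / ε) (𝓝[>] 0) (𝓝 0) := by
  have h1 := h.one_lt
  -- Any exponent strictly between `1` and `β₀` would do.
  have h2 := h.lower ((1 + β₀) / 2) ⟨by linarith, by linarith⟩
  have h3 : Tendsto (fun ε : ℝ => ε ^ ((1 + β₀) / 2 - 1)) (𝓝[>] 0) (𝓝 0) := by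
    have h4 : 0 < (1 + β₀) / 2 - 1 := by linarith
    have := ((Real.continuousAt_rpow_const 0 _ (Or.inr h4.le)).tendsto).mono_left
      (nhdsWithin_le_nhds (s := Ioi 0))
    rwa [Real.zero_rpow h4.ne'] at this
  have h4 := h2.mul h3
  rw [zero_mul] at h4
  refine h4.congr' ?_
  filter_upwards [eventually_pos_nhdsGT] with ε hε
  rw [Real.rpow_sub_one hε.ne']
  have := Real.rpow_pos_of_pos hε ((1 + β₀) / 2)
  field_simp

theorem tendsto_div_sq_atTop (h : IsNonPowerScale β₀ t) (hβ : β₀ < 2) :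
    Tendsto (fun ε => t ε / ε ^ 2) (𝓝[>] 0) atTop := by
  simpa only [Real.rpow_two] using h.upper 2 hβ

theorem tendsto_div_sq_zero (h : IsNonPowerScale β₀ t) (hβ : 2 < β₀) :
    Tendsto (fun ε => t ε / ε ^ 2) (𝓝[>] 0) (𝓝 0) := by
  simpa only [Real.rpow_two] using h.lower 2 ⟨one_lt_two, hβ⟩

theorem tendsto_abs_log (h : IsNonPowerScale β₀ t) (ht : ∀ᶠ ε in 𝓝[>] 0, 0 < t ε) :
    Tendsto (fun ε => |Real.log (t ε / ε ^ β₀)|) (𝓝[>] 0) atTop := by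
  rcases h.critical with h0 | h0
  · refine tendsto_abs_atBot_atTop.comp (Real.tendsto_log_nhdsGT_zero.comp
      (tendsto_nhdsWithin_iff.2 ⟨h0, ?_⟩))
    filter_upwards [ht, eventually_pos_nhdsGT] with ε h1 h2
    exact div_pos h1 (Real.rpow_pos_of_pos h2 _)
  · exact tendsto_abs_atTop_atTop.comp (Real.tendsto_log_atTop.comp h0)

/-- The distance is squeezed between `ε^(β₀+c')` and `ε^(β₀-c')` for every small `c'`; the cap on
`c'` keeps `β₀ - c'` above `1`. -/
theorem isLittleO_log (h : IsNonPowerScale β₀ t) (ht : ∀ᶠ ε in 𝓝[>] 0, 0 < t ε) :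
    (fun ε => Real.log (t ε / ε ^ β₀)) =o[𝓝[>] 0] (fun ε => Real.log (1 / ε)) := by
  refine isLittleO_iff.2 fun c hc => ?_
  have h1 := h.one_lt
  set c' := min c ((β₀ - 1) / 2) with hc'
  have hc0 : 0 < c' := lt_min hc (by linarith)
  have hc1 : c' ≤ (β₀ - 1) / 2 := min_le_right _ _
  have hc2 : c' ≤ c := min_le_left _ _
  have e1 := (h.lower (β₀ - c') ⟨by linarith, by linarith⟩).eventually (gt_mem_nhds zero_lt_one)
  have e2 := (h.upper (β₀ + c') (by simpa using hc0)).eventually (eventually_gt_atTop 1)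
  filter_upwards [e1, e2, ht, eventually_pos_nhdsGT,
    tendsto_log_one_div.eventually (eventually_gt_atTop 0)] with ε h3 h4 h5 h6 h7
  have h8 := Real.log_neg (div_pos h5 (Real.rpow_pos_of_pos h6 _)) h3
  have h9 := Real.log_pos h4
  rw [log_div_rpow h5 h6] at h8 h9 ⊢
  rw [Real.norm_eq_abs, Real.norm_eq_abs, abs_of_pos h7]
  refine le_trans ?_ (mul_le_mul_of_nonneg_right hc2 h7.le)
  rw [abs_le]
  constructor <;> linarith

end IsNonPowerScale

theorem tendsto_log_iterate (n : ℕ) : Tendsto (Real.log^[n]) atTop atTop :=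
  Real.tendsto_log_atTop.iterate n

theorem log_iterate_succ_isLittleO (n : ℕ) : (Real.log^[n + 1]) =o[atTop] (id : ℝ → ℝ) := by
  induction n with
  | zero => exact Real.isLittleO_log_id_atTop
  | succ n ih =>
    have h1 := Real.isLittleO_log_id_atTop.comp_tendsto (tendsto_log_iterate (n + 1))
    rw [Function.iterate_succ' _ (n + 1)]
    exact h1.trans_isBigO ih.isBigO

theorem tendsto_log_rpow_neg {Θ : ℝ} (hΘ : 0 < Θ) :
    Tendsto (fun ε : ℝ => Real.log (1 / ε) ^ (-Θ)) (𝓝[>] 0) (𝓝 0) :=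
  (tendsto_rpow_neg_atTop hΘ).comp tendsto_log_one_div

theorem tendsto_kappa {Θ : ℝ} (hΘ : 0 < Θ) : Tendsto (kappa Θ) (𝓝[>] 0) (𝓝 1) := by
  have h := (tendsto_log_rpow_neg hΘ).const_sub 1
  rwa [sub_zero] at h

theorem tendsto_beta₁ {Θ : ℝ} (hΘ : 0 < Θ) (γ : ℝ) : Tendsto (beta₁ Θ γ) (𝓝[>] 0) (𝓝 1) := by
  have h := ((tendsto_log_rpow_neg hΘ).const_mul γ).const_add 1
  rwa [mul_zero, add_zero] at h

theorem tendsto_beta₂ {n : ℕ} (hn : 2 ≤ n) (γ τ : ℝ) :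
    Tendsto (beta₂ n γ τ) (𝓝[>] 0) (𝓝 1) := by
  -- One logarithm is absorbed into `log (1/ε)`, and at least one more remains, which makes the
  -- quotient vanish.
  obtain ⟨m, rfl⟩ : ∃ m, n = m + 1 + 1 := ⟨n - 2, by omega⟩
  have h1 := ((log_iterate_succ_isLittleO m).tendsto_div_nhds_zero).comp tendsto_log_one_div
  have h2 := (tendsto_inv_atTop_zero.comp tendsto_log_one_div).const_mul τ
  have h3 := ((h1.const_mul γ).add h2).const_add 1
  rw [mul_zero, mul_zero, add_zero, add_zero] at h3
  refine h3.congr fun ε => ?_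
  simp only [beta₂, Function.comp_apply, id_eq, Function.iterate_succ_apply _ (m + 1)]
  ring

theorem eventually_mem_Icc_of_tendsto_one {b : ℝ → ℝ} (hb : Tendsto b (𝓝[>] 0) (𝓝 1))
    {κ β : ℝ} (hκ : κ < 1) (hβ : 1 < β) (R : ℝ) :
    ∀ᶠ ε : ℝ in 𝓝[>] 0, R - ε ^ b ε ∈ Icc (R - ε ^ κ) (R - ε ^ β) := by
  filter_upwards [hb.eventually (lt_mem_nhds hκ), hb.eventually (gt_mem_nhds hβ),
    Ioo_mem_nhdsGT (zero_lt_one' ℝ)] with ε h1 h2 h3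
  exact ⟨sub_le_sub_left (Real.rpow_le_rpow_of_exponent_ge h3.1 h3.2.le h1.le) _,
    sub_le_sub_left (Real.rpow_le_rpow_of_exponent_ge h3.1 h3.2.le h2.le) _⟩

theorem beta₁_sub_one_mul {Θ γ : ℝ} :
    (fun ε => (beta₁ Θ γ ε - 1) * Real.log (1 / ε)) =ᶠ[𝓝[>] 0]
      fun ε => γ * Real.log (1 / ε) ^ (1 - Θ) := by
  filter_upwards [tendsto_log_one_div.eventually (eventually_gt_atTop 0)] with ε h
  rw [beta₁, sub_eq_add_neg 1 Θ, Real.rpow_add h, Real.rpow_one]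
  ring

theorem beta₂_sub_one_mul {n : ℕ} {γ τ : ℝ} :
    (fun ε => (beta₂ n γ τ ε - 1) * Real.log (1 / ε)) =ᶠ[𝓝[>] 0]
      fun ε => γ * Real.log^[n] (1 / ε) + τ := by
  filter_upwards [tendsto_log_one_div.eventually (eventually_gt_atTop 0)] with ε h
  rw [beta₂, add_sub_cancel_left]
  field_simp

/-- Boundary distances `ε ^ b(ε)` with `b(ε) → 1` but `ε ^ (b(ε) - 1) → 0`. -/
theorem asymptotics_of_exponent {N : ℕ} (hN : 2 ≤ N) {R A B p q : ℝ} (hB : 0 < B) {g : ℝ → ℝ}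
    (d : IsLayerData R p q A (R * (B - A) / (N * g R)) g)
    (hg : ∀ r ∈ Ioo 0 R, DifferentiableAt ℝ g r) {U : ℝ → ℝ → ℝ}
    (hU : ∀ ε : ℝ, 0 < ε → IsNeumannSolution N R A B p q g ε (U ε)) {b : ℝ → ℝ}
    (hb : Tendsto b (𝓝[>] 0) (𝓝 1))
    (hb' : Tendsto (fun ε => (b ε - 1) * Real.log (1 / ε)) (𝓝[>] 0) atTop) :
    Tendsto (fun ε => U ε (R - ε ^ b ε) - (-(2 / q) * ((b ε - 1) * Real.log (1 / ε)) +
      1 / q * Real.log (q * A / (2 * g R)))) (𝓝[>] 0) (𝓝 0) ∧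
    (fun ε => deriv (U ε) (R - ε ^ b ε)) ~[𝓝[>] 0] (fun ε => -(2 / q) * ε ^ (-b ε)) ∧
    (fun ε => rho N R A B p q (U ε) (R - ε ^ b ε)) ~[𝓝[>] 0]
      (fun ε => 2 * g R / q * ε ^ (-2 * (b ε - 1))) := by
  have hA := d.A_pos
  have hq := d.q_pos
  have hgR := d.g_pos R ⟨d.R_pos.le, le_rfl⟩
  have ht : ∀ᶠ ε : ℝ in 𝓝[>] 0, 0 < ε ^ b ε :=
    eventually_pos_nhdsGT.mono fun ε hε => Real.rpow_pos_of_pos hε _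
  have hdiv : ∀ ε : ℝ, 0 < ε → ε ^ b ε / ε = Real.exp (-((b ε - 1) * Real.log (1 / ε))) := by
    intro ε hε
    rw [← rpow_eq_exp_neg_mul_log hε, Real.rpow_sub_one hε.ne']
  have ht1 : Tendsto (fun ε : ℝ => ε ^ b ε / ε) (𝓝[>] 0) (𝓝 0) := by
    refine (Real.tendsto_exp_neg_atTop_nhds_zero.comp hb').congr' ?_
    filter_upwards [eventually_pos_nhdsGT] with ε hε
    exact (hdiv ε hε).symm
  have ht2 : Tendsto (fun ε : ℝ => ε ^ b ε / ε ^ 2) (𝓝[>] 0) atTop := by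
    have h1 : Tendsto (fun ε => 2 - b ε) (𝓝[>] 0) (𝓝 1) := by
      convert hb.const_sub 2 using 2; norm_num
    have h2 := Real.tendsto_exp_atTop.comp (h1.pos_mul_atTop one_pos tendsto_log_one_div)
    refine h2.congr' ?_
    filter_upwards [eventually_pos_nhdsGT] with ε hε
    rw [← Real.rpow_two, ← Real.rpow_sub hε, rpow_eq_exp_neg_mul_log hε, Function.comp_apply]
    ring_nf
  obtain ⟨h1, h2, h3⟩ := asymptotics_of_sq_isLittleO hN hB d hg hU ht ht1 ht2
  refine ⟨h1.congr' ?_, h2.congr_right ?_, h3.congr_right ?_⟩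
  · filter_upwards [eventually_pos_nhdsGT] with ε hε
    rw [hdiv ε hε, Real.log_exp, Real.log_sqrt (by positivity)]
    ring
  · filter_upwards [eventually_pos_nhdsGT] with ε hε
    rw [Real.rpow_neg hε.le]
    have := Real.rpow_pos_of_pos hε (b ε)
    field_simp
  · filter_upwards [eventually_pos_nhdsGT] with ε hε
    have h4 : ε / ε ^ b ε = ε ^ (-(b ε - 1)) := by
      rw [Real.rpow_neg hε.le, Real.rpow_sub_one hε.ne', inv_div]
    rw [h4, ← Real.rpow_two, ← Real.rpow_mul hε.le]
    ring_nf

theorem tendsto_rpow_kappa {Θ : ℝ} (hΘ : 0 < Θ) :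
    Tendsto (fun ε : ℝ => ε ^ kappa Θ ε) (𝓝[>] 0) (𝓝 0) := by
  have h1 := Real.tendsto_exp_neg_atTop_nhds_zero.comp
    ((tendsto_kappa hΘ).pos_mul_atTop one_pos tendsto_log_one_div)
  refine h1.congr' ?_
  filter_upwards [eventually_pos_nhdsGT] with ε hε
  rw [rpow_eq_exp_neg_mul_log hε, Function.comp_apply]

/-- With `L = log (1/ε)` and `y = L^(1-Θ)`, one has `t/ε = e^y` while `t⁻² ≤ e^(2L)` and `L =
y^(1/(1-Θ))` is only a power of `y`. So `e^(-σ e^y)` wins, with half of its exponent spent on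
absorbing `t⁻²`. -/
theorem tendsto_decay_kappa {Θ : ℝ} (hΘ : Θ ∈ Ioo 0 1) {σ : ℝ} (hσ : 0 < σ) :
    Tendsto (fun ε : ℝ => 1 / (ε ^ kappa Θ ε) ^ 2 * Real.exp (-(σ * ε ^ kappa Θ ε / ε)))
      (𝓝[>] 0) (𝓝 0) := by
  have hΘ1 : 0 < 1 - Θ := sub_pos.2 hΘ.2
  have hy : Tendsto (fun ε : ℝ => Real.log (1 / ε) ^ (1 - Θ)) (𝓝[>] 0) atTop :=
    (tendsto_rpow_atTop hΘ1).comp tendsto_log_one_div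
  have hexp : Tendsto (fun y : ℝ => Real.exp (-(σ / 2 * Real.exp y))) atTop (𝓝 0) :=
    Real.tendsto_exp_neg_atTop_nhds_zero.comp
      (Real.tendsto_exp_atTop.const_mul_atTop (by positivity : 0 < σ / 2))
  have hlo := (isLittleO_iff.1 (isLittleO_rpow_exp_atTop (1 - Θ)⁻¹)) (by positivity : 0 < σ / 4)
  refine squeeze_zero' ?_ ?_ (hexp.comp hy)
  · exact Eventually.of_forall fun ε => by positivity
  · filter_upwards [hy.eventually hlo, eventually_pos_nhdsGT,
      tendsto_log_one_div.eventually (eventually_gt_atTop 0)] with ε h1 hε hL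
    set L := Real.log (1 / ε) with hL_def
    have hκ : kappa Θ ε * L = L - L ^ (1 - Θ) := by
      rw [kappa, ← hL_def, sub_eq_add_neg 1 Θ, Real.rpow_add hL, Real.rpow_one]; ring
    have hk1 : ε ^ kappa Θ ε = Real.exp (-(L - L ^ (1 - Θ))) := by
      rw [rpow_eq_exp_neg_mul_log hε, ← hL_def, hκ]
    have hε1 : ε = Real.exp (-L) := by
      rw [hL_def, one_div, Real.log_inv, neg_neg, Real.exp_log hε]
    have hdiv : ε ^ kappa Θ ε / ε = Real.exp (L ^ (1 - Θ)) := by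
      calc ε ^ kappa Θ ε / ε = Real.exp (-(L - L ^ (1 - Θ))) / Real.exp (-L) := by rw [hk1, ← hε1]
        _ = Real.exp (L ^ (1 - Θ)) := by rw [← Real.exp_sub]; ring_nf
    have hy0 : 0 ≤ L ^ (1 - Θ) := by positivity
    rw [← Real.rpow_mul hL.le, mul_inv_cancel₀ hΘ1.ne', Real.rpow_one, Real.norm_of_nonneg hL.le,
      Real.norm_of_nonneg (Real.exp_pos _).le] at h1
    rw [mul_div_assoc, hdiv, hk1, Function.comp_apply, ← Real.exp_nat_mul, one_div, ← Real.exp_neg,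
      ← Real.exp_add, Real.exp_le_exp]
    push_cast
    linarith

end CCPB

/-! ### Assembly of the two statements. -/

theorem theorem5p2 (N : ℕ) (hN : 2 ≤ N) (R A B p q : ℝ) (hR : 0 < R) (hA : 0 < A) (hAB : A < B)
    (hp : 0 < p) (hq : 0 < q) (g : ℝ → ℝ) (hg : ContDiffOn ℝ ∞ g (Icc 0 R))
    (hgpos : ∀ r ∈ Icc 0 R, 0 < g r) (U : ℝ → ℝ → ℝ)
    (hU : ∀ ε : ℝ, 0 < ε → CCPB.IsNeumannSolution N R A B p q g ε (U ε)) :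
    -- (I): points whose distance to the boundary is not comparable to a power
    (∀ (β₀ : ℝ) (r : ℝ → ℝ), (∀ᶠ ε in 𝓝[>] 0, r ε ∈ Ioo 0 R) →
      CCPB.IsNonPowerScale β₀ (fun ε => R - r ε) →
      -- (a)
      ((β₀ < 2 ∨ (β₀ = 2 ∧ Tendsto (fun ε => (R - r ε) / ε ^ 2) (𝓝[>] 0) atTop)) →
        Tendsto (fun ε => U ε (r ε) -
          (-(2 / q) * (β₀ - 1) * Real.log (1 / ε) + 2 / q * Real.log ((R - r ε) / ε ^ β₀) +
            2 / q * Real.log (Real.sqrt (q * A / (2 * g R))))) (𝓝[>] 0) (𝓝 0) ∧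
        (fun ε => deriv (U ε) (r ε)) ~[𝓝[>] 0] (fun ε => -(2 / (q * (R - r ε)))) ∧
        (fun ε => CCPB.rho N R A B p q (U ε) (r ε)) ~[𝓝[>] 0]
          (fun ε => 2 * g R / q * (ε / (R - r ε)) ^ 2) ∧
        Tendsto (fun ε => |-(2 / q) * (β₀ - 1) * Real.log (1 / ε)|) (𝓝[>] 0) atTop ∧
        Tendsto (fun ε => |2 / q * Real.log ((R - r ε) / ε ^ β₀)|) (𝓝[>] 0) atTop ∧
        (fun ε => Real.log ((R - r ε) / ε ^ β₀)) =o[𝓝[>] 0] (fun ε => Real.log (1 / ε))) ∧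
      -- (b)
      ((2 < β₀ ∨ (β₀ = 2 ∧ Tendsto (fun ε => (R - r ε) / ε ^ 2) (𝓝[>] 0) (𝓝 0))) →
        Tendsto (fun ε => U ε (r ε) -
          (-(2 / q) * Real.log (1 / ε) +
            2 / q * Real.log (Real.sqrt (A / (2 * q * g R)) * (2 * N * g R / (R * (B - A))))))
          (𝓝[>] 0) (𝓝 0) ∧
        (fun ε => deriv (U ε) (r ε)) ~[𝓝[>] 0]
          (fun ε => -(R * (B - A) / (N * g R)) * (ε ^ 2)⁻¹) ∧
        (fun ε => CCPB.rho N R A B p q (U ε) (r ε)) ~[𝓝[>] 0]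
          (fun ε => q * R ^ 2 * (B - A) ^ 2 / (2 * N ^ 2 * g R) * (ε ^ 2)⁻¹))) ∧
    -- (II): exponents tending to one
    (∀ (Θ γ τ : ℝ) (n : ℕ), Θ ∈ Ioo 0 1 → 0 < γ → 2 ≤ n →
      (∀ κ ∈ Ioo (0 : ℝ) 1, ∀ β ∈ Ioi (1 : ℝ), ∀ᶠ ε : ℝ in 𝓝[>] 0,
        R - ε ^ CCPB.kappa Θ ε ∈ Icc (R - ε ^ κ) (R - ε ^ β) ∧
        R - ε ^ CCPB.beta₁ Θ γ ε ∈ Icc (R - ε ^ κ) (R - ε ^ β) ∧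
        R - ε ^ CCPB.beta₂ n γ τ ε ∈ Icc (R - ε ^ κ) (R - ε ^ β)) ∧
      Tendsto (fun ε => |U ε (R - ε ^ CCPB.kappa Θ ε)|) (𝓝[>] 0) (𝓝 0) ∧
      Tendsto (fun ε => |deriv (U ε) (R - ε ^ CCPB.kappa Θ ε)|) (𝓝[>] 0) (𝓝 0) ∧
      Tendsto (fun ε => U ε (R - ε ^ CCPB.beta₁ Θ γ ε) -
        (-(2 * γ / q) * Real.log (1 / ε) ^ (1 - Θ) + 1 / q * Real.log (q * A / (2 * g R))))
        (𝓝[>] 0) (𝓝 0) ∧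
      Tendsto (fun ε => U ε (R - ε ^ CCPB.beta₂ n γ τ ε) -
        (-(2 * γ / q) * Real.log^[n] (1 / ε) +
          1 / q * (-2 * τ + Real.log (q * A / (2 * g R)))))
        (𝓝[>] 0) (𝓝 0) ∧
      (fun ε => deriv (U ε) (R - ε ^ CCPB.beta₁ Θ γ ε)) ~[𝓝[>] 0]
        (fun ε => -(2 / q) * ε ^ (-CCPB.beta₁ Θ γ ε)) ∧
      (fun ε => CCPB.rho N R A B p q (U ε) (R - ε ^ CCPB.beta₁ Θ γ ε)) ~[𝓝[>] 0]
        (fun ε => 2 * g R / q * ε ^ (-2 * (CCPB.beta₁ Θ γ ε - 1))) ∧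
      (n = 2 → 2 < γ →
        (fun ε => deriv (U ε) (R - ε ^ CCPB.beta₂ n γ τ ε)) ~[𝓝[>] 0]
          (fun ε => -(2 / q) * ε ^ (-CCPB.beta₂ n γ τ ε)) ∧
        (fun ε => CCPB.rho N R A B p q (U ε) (R - ε ^ CCPB.beta₂ n γ τ ε)) ~[𝓝[>] 0]
          (fun ε => 2 * g R / q * ε ^ (-2 * (CCPB.beta₂ n γ τ ε - 1))))) := by
  have hB : 0 < B := hA.trans hAB
  have hRmem : R ∈ Icc 0 R := ⟨hR.le, le_rfl⟩
  have hgR := hgpos R hRmem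
  have hN0 : (0 : ℝ) < N := by exact_mod_cast (by omega : 0 < N)
  have hBA : 0 < B - A := sub_pos.2 hAB
  have d : CCPB.IsLayerData R p q A (R * (B - A) / (N * g R)) g :=
    ⟨hR, hp, hq, hA, by positivity, hg.continuousOn, hgpos⟩
  have hgd : ∀ r ∈ Ioo 0 R, DifferentiableAt ℝ g r := fun r hr =>
    (hg.differentiableOn (by simp)).differentiableAt (Icc_mem_nhds hr.1 hr.2)
  refine ⟨fun β₀ r hr hs => ⟨fun hcase => ?_, fun hcase => ?_⟩,
    fun Θ γ τ n hΘ hγ hn => ⟨fun κ hκ β hβ => ?_, ?_⟩⟩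
  · have ht : ∀ᶠ ε in 𝓝[>] 0, 0 < R - r ε := hr.mono fun ε h => sub_pos.2 h.2
    have ht2 : Tendsto (fun ε => (R - r ε) / ε ^ 2) (𝓝[>] 0) atTop :=
      hcase.elim hs.tendsto_div_sq_atTop And.right
    obtain ⟨h1, h2, h3⟩ := CCPB.asymptotics_of_sq_isLittleO hN hB d hgd hU ht hs.tendsto_div ht2
    simp only [sub_sub_cancel] at h1 h2 h3
    have hβ := hs.one_lt
    refine ⟨h1.congr' ?_, h2, h3, ?_, ?_, hs.isLittleO_log ht⟩
    -- The logarithm of `(R - r)/ε` splits as that of `(R - r)/ε^β₀` minus `(β₀ - 1) log (1/ε)`.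
    · filter_upwards [ht, CCPB.eventually_pos_nhdsGT] with ε h4 h5
      have h6 := CCPB.log_div_rpow h4 h5 1
      rw [Real.rpow_one] at h6
      rw [CCPB.log_div_rpow h4 h5, h6]
      ring
    · refine tendsto_abs_atBot_atTop.comp
        (CCPB.tendsto_log_one_div.const_mul_atTop_of_neg ?_)
      have : 0 < 2 / q * (β₀ - 1) := mul_pos (by positivity) (by linarith)
      linarith
    · simp only [abs_mul]
      exact (hs.tendsto_abs_log ht).const_mul_atTop (abs_pos.2 (by positivity))
  · have ht : ∀ᶠ ε in 𝓝[>] 0, 0 < R - r ε := hr.mono fun ε h => sub_pos.2 h.2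
    have ht2 : Tendsto (fun ε => (R - r ε) / ε ^ 2) (𝓝[>] 0) (𝓝 0) :=
      hcase.elim hs.tendsto_div_sq_zero And.right
    have h := CCPB.asymptotics_of_isLittleO_sq hN hB d hgd hU ht hs.tendsto_div ht2
    simpa only [sub_sub_cancel] using h
  · exact (CCPB.eventually_mem_Icc_of_tendsto_one (CCPB.tendsto_kappa hΘ.1) hκ.2 hβ R).and
      ((CCPB.eventually_mem_Icc_of_tendsto_one (CCPB.tendsto_beta₁ hΘ.1 γ) hκ.2 hβ R).and
        (CCPB.eventually_mem_Icc_of_tendsto_one (CCPB.tendsto_beta₂ hn γ τ) hκ.2 hβ R))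
  · have hL := CCPB.tendsto_log_one_div
    have hlim₁ : Tendsto (fun ε => γ * Real.log (1 / ε) ^ (1 - Θ)) (𝓝[>] 0) atTop :=
      ((tendsto_rpow_atTop (sub_pos.2 hΘ.2)).comp hL).const_mul_atTop hγ
    have hlim₂ : Tendsto (fun ε => γ * Real.log^[n] (1 / ε) + τ) (𝓝[>] 0) atTop := by
      refine tendsto_atTop_add_const_right _ τ (Tendsto.const_mul_atTop hγ ?_)
      simp only [one_div]
      exact (CCPB.tendsto_log_iterate n).comp tendsto_inv_nhdsGT_zero
    obtain ⟨hU1, hD1⟩ := CCPB.tendsto_zero_of_decay hN hB d hgd hU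
      (CCPB.eventually_pos_nhdsGT.mono fun ε hε => Real.rpow_pos_of_pos hε (CCPB.kappa Θ ε))
      (CCPB.tendsto_rpow_kappa hΘ.1) (fun σ hσ => CCPB.tendsto_decay_kappa hΘ hσ)
    obtain ⟨a1, a2, a3⟩ := CCPB.asymptotics_of_exponent hN hB d hgd hU
      (CCPB.tendsto_beta₁ hΘ.1 γ) (hlim₁.congr' CCPB.beta₁_sub_one_mul.symm)
    obtain ⟨b1, b2, b3⟩ := CCPB.asymptotics_of_exponent hN hB d hgd hU
      (CCPB.tendsto_beta₂ hn γ τ) (hlim₂.congr' CCPB.beta₂_sub_one_mul.symm)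
    refine ⟨by simpa using hU1.abs, by simpa using hD1.abs, a1.congr' ?_, b1.congr' ?_, a2, a3,
      fun _ _ => ⟨b2, b3⟩⟩
    · filter_upwards [CCPB.beta₁_sub_one_mul (Θ := Θ) (γ := γ)] with ε h
      rw [h]
      ring
    · filter_upwards [CCPB.beta₂_sub_one_mul (n := n) (γ := γ) (τ := τ)] with ε h
      rw [h]
      ring
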